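/- Let $H$ be a normal subgroup of a discrete group $G$ such that $G/H$ is finitely generated and amenable, and let $p:G\to G/H$ be the projection. Let $\sigma'$ be a multiplier on $G/H$, i.e. a map $\sigma':G/H\times G/H\to U(1)$ with $\sigma'(b,c)\sigma'(a,bc)=\sigma'(ab,c)\sigma'(a,b)$ and $\sigma'(1,g)=\sigma'(g,1)=1$, and let $\sigma=p^*\sigma'$, $\sigma(g,h)=\sigma'(p(g),p(h))$, be its pullback to $G$. Let $d\ge 0$ and let $A\in M_d(\mathbb C(G,\sigma))$ be a matrix over the twisted group algebra, with coefficient matrices $A(g)\in M_d(\mathbb C)$ (zero for all but finitely many $g$). It acts on $l^2(G)^d$ as the bounded operator $$(Af)(x)=\sum_{h\in G}A(xh^{-1})\,\sigma(xh^{-1},h)\,f(h),$$ and we assume that this operator is self-adjoint. Let $\mathcal A=W_L^*(G,\sigma)\otimes M_d(\mathbb C)$ be the von Neumann algebra of bounded operators on $l^2(G)^d$ commuting with all right magnetic translations $(R_g^{\bar\sigma}f)(x)=f(xg)\overline{\sigma(x,g)}$, with trace $\tau(T)=\sum_{a=1}^d (T_{a,a}\delta_e,\delta_e)$. For a finite subset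 $X\subset G/H$ let $\mathcal H_X=l^2(p^{-1}(X))^d$ be the space of functions in $l^2(G)^d$ supported on $p^{-1}(X)$, let $P_X$ be the orthogonal projection onto $\mathcal H_X$, let $\mathcal A_X=B(\mathcal H_X)^H$ be the commutant of the right $H$-translations $f\mapsto f(\,\cdot\,h)$ on $\mathcal H_X$, and let $A^{(X)}=P_XA|_{\mathcal H_X}$. Let $s$ be any right inverse of $p$ and, for non-empty $X$, let $$\tau_X(B)=\frac1{\#X}\sum_{a=1}^d\sum_{x\in X}(B_{a,a})_{s(x),s(x)}.$$ Let $S$ be a finite generating set of $G/H$ and let $d_S(x,y)$ be the right-invariant word metric, i.e. the word length of $xy^{-1}$ with respect to $S$. Let $(X_m)$ be a sequence of non-empty finite subsets of $G/H$ satisfying the Følner condition $$\lim_{m\to\infty}\frac{\#\partial_\delta X_m}{\#X_m}=0\quad\text{for every }\delta\in\mathbb N,\qquad \partial_\delta X=\{y\notin X: d_S(y,x)\le\delta\text{ for some }x\in X\}$$ (for instance a Følner exhaustion of $G/H$, which in addition is increasing with union $G/H$). Then $A$ and its spectral projections $\chi_{(-\infty,\lambda]}(A)$ belong to $\mathcal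 A$; for every finite $X\subset G/H$, $A^{(X)}$ and its spectral projections $\chi_{(-\infty,\lambda]}(A^{(X)})$ belong to $\mathcal A_X$; and the spectral density functions $$F_m(\lambda)=\tau_{X_m}\big(\chi_{(-\infty,\lambda]}(A^{(X_m)})\big),\qquad F(\lambda)=\tau\big(\chi_{(-\infty,\lambda]}(A)\big)$$ satisfy $$\lim_{m\to\infty}F_m(\lambda)=F(\lambda)\qquad\text{for every }\lambda\in\mathbb R.$$ -/

import Mathlib

open Filter Topology

noncomputable section

namespace TwistedGroup

/-- A multiplier on a group: a normalized `U(1)`-valued 2-cocycle. -/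
structure Multiplier (G : Type*) [Group G] where
  toFun : G → G → Circle
  cocycle : ∀ a b c : G, toFun b c * toFun a (b * c) = toFun (a * b) c * toFun a b
  one_left : ∀ g : G, toFun 1 g = 1
  one_right : ∀ g : G, toFun g 1 = 1

/-- The trivial multiplier. -/
def Multiplier.trivial (G : Type*) [Group G] : Multiplier G where
  toFun _ _ := 1
  cocycle _ _ _ := rfl
  one_left _ := rfl
  one_right _ := rfl

/-- The pullback `p^* σ'` of a multiplier along a homomorphism. -/
def Multiplier.pullback {G Q : Type*} [Group G] [Group Q] (σ' : Multiplier Q) (p : G →* Q) :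
    Multiplier G where
  toFun g h := σ'.toFun (p g) (p h)
  cocycle a b c := by simpa using σ'.cocycle (p a) (p b) (p c)
  one_left g := by simpa using σ'.one_left (p g)
  one_right g := by simpa using σ'.one_right (p g)

/-- The conjugate multiplier. -/
def Multiplier.conj {G : Type*} [Group G] (σ : Multiplier G) : Multiplier G where
  toFun g h := (σ.toFun g h)⁻¹
  cocycle a b c := by
    rw [← mul_inv, ← mul_inv, σ.cocycle]
  one_left g := by simp [σ.one_left]
  one_right g := by simp [σ.one_right]

/-- The twisted group algebra `ℂ(G,σ)`: finite formal sums `∑ a_g g`. -/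
def TwistedGroupAlgebra {G : Type*} [Group G] (_σ : Multiplier G) : Type _ := G →₀ ℂ

instance {G : Type*} [Group G] (σ : Multiplier G) : AddCommGroup (TwistedGroupAlgebra σ) :=
  inferInstanceAs (AddCommGroup (G →₀ ℂ))

/-- The coefficient of `g`. -/
def TwistedGroupAlgebra.coeff {G : Type*} [Group G] {σ : Multiplier G}
    (a : TwistedGroupAlgebra σ) : G →₀ ℂ := a

/-- Twisted multiplication: `(∑ a_g g) (∑ b_h h) = ∑ a_g b_h σ(g,h) gh`. -/
instance {G : Type*} [Group G] (σ : Multiplier G) : Mul (TwistedGroupAlgebra σ) where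
  mul a b := (a.coeff.sum fun g z => b.coeff.sum fun h w =>
    Finsupp.single (g * h) (z * w * (σ.toFun g h : ℂ)) : G →₀ ℂ)

/-- The Hilbert space `l²(G)^d` of square-summable `ℂ^d`-valued functions on `G`. -/
abbrev L2 (G : Type*) (d : ℕ) : Type _ := lp (fun _ : G => EuclideanSpace ℂ (Fin d)) 2

theorem memlp_comp {G : Type*} {d : ℕ} (e : G ≃ G)
    (c : G → (EuclideanSpace ℂ (Fin d) →L[ℂ] EuclideanSpace ℂ (Fin d))) (C : ℝ)
    (hc : ∀ x, ‖c x‖ ≤ C) (f : L2 G d) :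
    Memℓp (E := fun _ : G => EuclideanSpace ℂ (Fin d)) (fun x => c x (f (e x))) 2 := by
  have hf : Summable fun x => ‖f (e x)‖ ^ (2 : ℝ) := by
    have := (memℓp_gen_iff (p := 2) (by simp)).1 (lp.memℓp f)
    exact (e.summable_iff (f := fun x => ‖f x‖ ^ (2 : ℝ))).2 (by simpa using this)
  refine memℓp_gen ?_
  refine Summable.of_nonneg_of_le (fun x => by positivity) (fun x => ?_) (hf.mul_left (C ^ (2 : ℝ)))
  have hC : 0 ≤ C := (norm_nonneg _).trans (hc x)
  rw [← Real.mul_rpow hC (norm_nonneg _)]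
  simp only [ENNReal.toReal_ofNat]
  exact Real.rpow_le_rpow (norm_nonneg _) ((c x).le_of_opNorm_le (hc x) _) (by norm_num)

theorem norm_comp_le {G : Type*} {d : ℕ} (e : G ≃ G)
    (c : G → (EuclideanSpace ℂ (Fin d) →L[ℂ] EuclideanSpace ℂ (Fin d))) (C : ℝ) (hC : 0 ≤ C)
    (hc : ∀ x, ‖c x‖ ≤ C) (f : L2 G d) :
    ‖(⟨_, memlp_comp e c C hc f⟩ : L2 G d)‖ ≤ C * ‖f‖ := by
  refine lp.norm_le_of_forall_sum_le (by simp) (by positivity) fun t => ?_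
  have h := lp.sum_rpow_le_norm_rpow (p := 2) (by simp) f (t.map e.toEmbedding)
  simp only [ENNReal.toReal_ofNat, Finset.sum_map] at h ⊢
  rw [Real.mul_rpow hC (norm_nonneg _)]
  refine le_trans ?_ (mul_le_mul_of_nonneg_left h (by positivity))
  rw [Finset.mul_sum]
  refine Finset.sum_le_sum fun x _ => ?_
  rw [← Real.mul_rpow hC (norm_nonneg _)]
  exact Real.rpow_le_rpow (norm_nonneg _) ((c x).le_of_opNorm_le (hc x) _) (by norm_num)

/-- The bounded operator `f ↦ (x ↦ c x (f (e x)))` on `l²(G)^d`, for a permutation `e` of `G`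
and uniformly bounded `c x ∈ B(ℂ^d)`. -/
def weightedShift {G : Type*} {d : ℕ} (e : G ≃ G)
    (c : G → (EuclideanSpace ℂ (Fin d) →L[ℂ] EuclideanSpace ℂ (Fin d))) (C : ℝ) (hC : 0 ≤ C)
    (hc : ∀ x, ‖c x‖ ≤ C) : L2 G d →L[ℂ] L2 G d :=
  LinearMap.mkContinuous
    { toFun := fun f => ⟨fun x => c x (f (e x)), memlp_comp e c C hc f⟩
      map_add' := fun f g => by
        ext1
        funext x
        exact (c x).map_add (f (e x)) (g (e x))
      map_smul' := fun z f => by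
        ext1
        funext x
        simp }
    C (norm_comp_le e c C hC hc)

theorem norm_phase_le {d : ℕ} (z : Circle) :
    ‖(z : ℂ) • ContinuousLinearMap.id ℂ (EuclideanSpace ℂ (Fin d))‖ ≤ 1 := by
  rw [norm_smul, Circle.norm_coe, one_mul]
  exact ContinuousLinearMap.norm_id_le

/-- Left magnetic translation: `(L^σ_g f)(x) = σ(g, g⁻¹x) f(g⁻¹x)`. -/
def leftTranslation {G : Type*} [Group G] (σ : Multiplier G) (d : ℕ) (g : G) :
    L2 G d →L[ℂ] L2 G d :=
  weightedShift (Equiv.mulLeft g⁻¹)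
    (fun x => (σ.toFun g (g⁻¹ * x) : ℂ) • ContinuousLinearMap.id ℂ _) 1 zero_le_one
    (fun _ => norm_phase_le _)

/-- Right magnetic translation: `(R^σ_g f)(x) = σ(x, g) f(xg)`. -/
def rightTranslation {G : Type*} [Group G] (σ : Multiplier G) (d : ℕ) (g : G) :
    L2 G d →L[ℂ] L2 G d :=
  weightedShift (Equiv.mulRight g)
    (fun x => (σ.toFun x g : ℂ) • ContinuousLinearMap.id ℂ _) 1 zero_le_one
    (fun _ => norm_phase_le _)

/-- A `d × d` matrix acting pointwise on `ℂ^d`-valued functions. -/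
def matrixAction (G : Type*) {d : ℕ} (M : Matrix (Fin d) (Fin d) ℂ) : L2 G d →L[ℂ] L2 G d :=
  weightedShift (Equiv.refl G) (fun _ => Matrix.toEuclideanCLM (𝕜 := ℂ) M)
    ‖Matrix.toEuclideanCLM (𝕜 := ℂ) M‖ (norm_nonneg _) (fun _ => le_rfl)

/-- The matrix `A(g)` of coefficients of `g` in the entries of `A ∈ M_d(ℂ(G,σ))`. -/
def coeffMatrix {G : Type*} [Group G] {σ : Multiplier G} {d : ℕ}
    (A : Matrix (Fin d) (Fin d) (TwistedGroupAlgebra σ)) (g : G) : Matrix (Fin d) (Fin d) ℂ :=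
  Matrix.of fun a b => (A a b).coeff g

open Classical in
/-- The finite set of group elements occurring in the entries of `A`. -/
def matrixSupport {G : Type*} [Group G] {σ : Multiplier G} {d : ℕ}
    (A : Matrix (Fin d) (Fin d) (TwistedGroupAlgebra σ)) : Finset G :=
  Finset.univ.biUnion fun a => Finset.univ.biUnion fun b => (A a b).coeff.support

/-- The operator on `l²(G)^d` of twisted left multiplication by `A ∈ M_d(ℂ(G,σ))`:
`∑_g A(g) L^σ_g`, i.e. `(A f)(x) = ∑_h A(x h⁻¹) σ(x h⁻¹, h) f(h)`. -/
def leftMul {G : Type*} [Group G] {σ : Multiplier G} {d : ℕ}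
    (A : Matrix (Fin d) (Fin d) (TwistedGroupAlgebra σ)) : L2 G d →L[ℂ] L2 G d :=
  ∑ g ∈ matrixSupport A, matrixAction G (coeffMatrix A g) ∘L leftTranslation σ d g

/-- The von Neumann algebra `W_L^*(G,σ) ⊗ M_d(ℂ) = B(l²(G)^d)^{G,σ}`: the commutant of the
right translations twisted by the conjugate of `σ`. -/
def twistedVN {G : Type*} [Group G] (σ : Multiplier G) (d : ℕ) :
    Subalgebra ℂ (L2 G d →L[ℂ] L2 G d) :=
  Subalgebra.centralizer ℂ (Set.range (rightTranslation σ.conj d))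

/-- The basis vector `δ_g ⊗ e_a` of `l²(G)^d`. -/
def delta {G : Type*} {d : ℕ} (g : G) (a : Fin d) : L2 G d :=
  open Classical in lp.single 2 g (EuclideanSpace.single a (1 : ℂ))

/-- The trace `τ(T) = ∑_a (T_{a,a} δ_e, δ_e)`. -/
def vnTrace {G : Type*} [Group G] {d : ℕ} (T : L2 G d →L[ℂ] L2 G d) : ℂ :=
  ∑ a : Fin d, (T (delta (1 : G) a) : G → EuclideanSpace ℂ (Fin d)) 1 a

/-- The subspace `l²(p⁻¹(X))^d` of functions in `l²(G)^d` supported on the preimage of `X`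
under `p : G → G/H`. -/
def supportedOn {G : Type*} [Group G] (H : Subgroup G) (d : ℕ) (X : Finset (G ⧸ H)) :
    Submodule ℂ (L2 G d) where
  carrier := {f | ∀ g : G, (g : G ⧸ H) ∉ X → f g = 0}
  add_mem' hf hg x hx := by simp [hf x hx, hg x hx]
  zero_mem' _ _ := rfl
  smul_mem' c f hf x hx := by simp [hf x hx]

theorem isClosed_supportedOn {G : Type*} [Group G] (H : Subgroup G) (d : ℕ)
    (X : Finset (G ⧸ H)) : IsClosed (supportedOn H d X : Set (L2 G d)) := by
  have h : (supportedOn H d X : Set (L2 G d)) =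
      ⋂ g : G, ⋂ _ : (g : G ⧸ H) ∉ X, {f : L2 G d | f g = 0} := by
    ext f
    simp only [Set.mem_iInter, Set.mem_ofPred_eq]
    rfl
  rw [h]
  refine isClosed_iInter fun g => isClosed_iInter fun _ => isClosed_eq ?_ continuous_const
  exact (continuous_apply g).comp (lp.uniformContinuous_coe (p := 2)).continuous

instance {G : Type*} [Group G] (H : Subgroup G) (d : ℕ) (X : Finset (G ⧸ H)) :
    CompleteSpace (supportedOn H d X) :=
  (isClosed_supportedOn H d X).completeSpace_coe

/-- The truncation `A^{(X)} = P_X A|_{l²(p⁻¹(X))^d}`. -/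
def truncation {G : Type*} [Group G] (H : Subgroup G) {d : ℕ} (X : Finset (G ⧸ H))
    (T : L2 G d →L[ℂ] L2 G d) : supportedOn H d X →L[ℂ] supportedOn H d X :=
  (supportedOn H d X).orthogonalProjectionOnto ∘L T ∘L (supportedOn H d X).subtypeL

theorem rightTranslation_mem {G : Type*} [Group G] (H : Subgroup G) (d : ℕ)
    (X : Finset (G ⧸ H)) (h : H) (f : supportedOn H d X) :
    rightTranslation (Multiplier.trivial G) d (h : G) f ∈ supportedOn H d X := by
  intro x hx
  have h1 : ((x * h : G) : G ⧸ H) ∉ X := by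
    rwa [QuotientGroup.mk_mul_of_mem x h.2]
  have h2 := f.2 (x * h) h1
  simp [rightTranslation, weightedShift, h2]

/-- The (untwisted) right translation `f ↦ f(· h)` by `h ∈ H` on `l²(p⁻¹(X))^d`. -/
def rightTranslationOn {G : Type*} [Group G] (H : Subgroup G) (d : ℕ) (X : Finset (G ⧸ H))
    (h : H) : supportedOn H d X →L[ℂ] supportedOn H d X :=
  (rightTranslation (Multiplier.trivial G) d (h : G) ∘L (supportedOn H d X).subtypeL).codRestrict
    (supportedOn H d X) (rightTranslation_mem H d X h)

/-- The algebra `B(l²(p⁻¹(X))^d)^H`: the commutant of the right `H`-translations. -/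
def equivariantAlgebra {G : Type*} [Group G] (H : Subgroup G) (d : ℕ) (X : Finset (G ⧸ H)) :
    Subalgebra ℂ (supportedOn H d X →L[ℂ] supportedOn H d X) :=
  Subalgebra.centralizer ℂ (Set.range (rightTranslationOn H d X))

theorem delta_mem {G : Type*} [Group G] (H : Subgroup G) {d : ℕ} (X : Finset (G ⧸ H))
    (g : G) (hg : (g : G ⧸ H) ∈ X) (a : Fin d) : delta g a ∈ supportedOn H d X := by
  intro x hx
  have : x ≠ g := fun h => hx (h ▸ hg)
  simp [delta, this]

/-- The trace `τ_X(B) = (1/#X) ∑_a ∑_{x ∈ X} (B_{a,a})_{s(x),s(x)}`, for a right inverse `s` of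
`p : G → G/H`. -/
def truncTrace {G : Type*} [Group G] (H : Subgroup G) {d : ℕ} (s : G ⧸ H → G)
    (hs : ∀ q : G ⧸ H, (s q : G ⧸ H) = q) (X : Finset (G ⧸ H))
    (B : supportedOn H d X →L[ℂ] supportedOn H d X) : ℂ :=
  (1 / (X.card : ℂ)) * ∑ a : Fin d, ∑ x ∈ X.attach,
    ((B ⟨delta (s x) a, delta_mem H X (s x) ((hs x).symm ▸ x.2) a⟩ : L2 G d) :
      G → EuclideanSpace ℂ (Fin d)) (s x) a

/-- The spectral projection `χ_{(-∞,t]}(T)` of a bounded self-adjoint operator `T`. As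
`χ_{(-∞,t]}` is the indicator function of the zero set of the continuous function
`u ↦ max (u - t) 0`, it is the orthogonal projection onto the kernel of `max (T - t) 0`,
taken in the continuous functional calculus. -/
def spectralProjection {E : Type*} [NormedAddCommGroup E] [InnerProductSpace ℂ E]
    [CompleteSpace E] (T : E →L[ℂ] E) (t : ℝ) : E →L[ℂ] E :=
  (cfc (fun u : ℝ => max (u - t) 0) T : E →L[ℂ] E).ker.starProjection

/-- Amenability of a discrete group: there is a left-invariant finitely additive probability
measure defined on all subsets. -/
def IsAmenable (Q : Type*) [Group Q] : Prop :=
  ∃ μ : Set Q → ℝ, (∀ E, 0 ≤ μ E) ∧ μ Set.univ = 1 ∧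
    (∀ E F, Disjoint E F → μ (E ∪ F) = μ E + μ F) ∧
    ∀ (q : Q) (E : Set Q), μ ((fun x => q * x) '' E) = μ E

/-- The word length of `q` with respect to `S`: the least length of a word in the elements of `S`
and their inverses that represents `q`. -/
def wordLength {Q : Type*} [Group Q] (S : Finset Q) (q : Q) : ℕ :=
  sInf {n | ∃ l : List Q, l.length = n ∧ (∀ x ∈ l, x ∈ S ∨ x⁻¹ ∈ S) ∧ l.prod = q}

/-- The right-invariant word metric. It is the invariance for which left multiplication operators
have bounded propagation. -/
def wordDist {Q : Type*} [Group Q] (S : Finset Q) (x y : Q) : ℕ := wordLength S (x * y⁻¹)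

/-- The (outer) `δ`-boundary of `X`: the `δ`-neighbourhood of `X`, without `X`. -/
def boundary {Q : Type*} [Group Q] (S : Finset Q) (δ : ℕ) (X : Finset Q) : Set Q :=
  {y | y ∉ X ∧ ∃ x ∈ X, wordDist S y x ≤ δ}

/-- The Følner condition on a sequence of non-empty finite subsets, with respect to the finite
generating set `S`. The sequence is not required to be increasing, or to exhaust the group, so
that Følner exhaustions are special cases. -/
structure IsFolner {Q : Type*} [Group Q] (S : Finset Q) (X : ℕ → Finset Q) : Prop where
  nonempty : ∀ m, (X m).Nonempty
  tendsto : ∀ δ : ℕ,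
    Tendsto (fun m => ((boundary S δ (X m)).ncard : ℝ) / ((X m).card : ℝ)) atTop (𝓝 0)

end TwistedGroup

end

open TwistedGroup

/-! Convergence of moments alone gives convergence of distribution functions only where the limit is
continuous. To reach every `t`, including eigenvalues of `A`, the normalized dimensions of the
`t`-eigenspaces of the truncations must also be controlled.

Upper bound. The moments of `A^{(X_m)}` converge to those of `A`: away from a thin boundary layer,
powers of the truncation agree on basis vectors with powers of `A`, which has finite propagation
over `G/H` (`tendsto_reTrace_truncation_pow`). By Weierstrass the traces of all continuous functions
converge. For continuous `g ≥ 0` the projection onto `ker g(T)` lies below `(1 + n g(T))⁻¹` and is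
its strong limit in `n`, so traces of such kernels are upper semicontinuous
(`eventually_reTrace_kerProj_le`). This applies to the positive and negative parts of `u - t`, whose
kernels give `χ_{(-∞,t]}` and `χ_{[t,∞)}`.

Lower bound. These two projections sum to `1 + χ_{{t}}`, so a lower bound on the dimension of the
`t`-eigenspace turns the upper bound for one into a lower bound for the other
(`tendsto_reTrace_spectralProjection`). To get it, let `P` project onto `ker (A - t)` and let `C` be
the truncation of `P`. The normalized trace of `C` is exactly that of `P`, while `C (A^{(X)} - t)`
kills every basis vector away from the boundary, since there it agrees with `P (A - t) = 0`. A
rank-nullity argument for the trace on the commutant of the right `H`-translations then bounds the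
trace of `C` by that of `ker (A^{(X)} - t)` plus the number of boundary vectors
(`reTrace_le_reTrace_kerProj_add`). No arithmetic property of the coefficients is needed. -/

open Filter Topology TwistedGroup

noncomputable section

namespace TwistedGroup

/-! ### Kernel projections and their approximation by resolvents -/

section

variable {E : Type*} [NormedAddCommGroup E] [InnerProductSpace ℂ E] [CompleteSpace E]

/-- The orthogonal projection onto the kernel of a bounded operator. -/
def kerProj (T : E →L[ℂ] E) : E →L[ℂ] E := T.ker.starProjection

theorem spectralProjection_eq_kerProj (T : E →L[ℂ] E) (t : ℝ) :
    spectralProjection T t = kerProj (cfc (fun u : ℝ => max (u - t) 0) T) := rfl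

theorem apply_kerProj (T : E →L[ℂ] E) (x : E) : T (kerProj T x) = 0 :=
  T.ker.starProjection_apply_mem x

theorem kerProj_apply_of_apply_eq_zero {T : E →L[ℂ] E} {x : E} (hx : T x = 0) :
    kerProj T x = x :=
  Submodule.starProjection_eq_self_iff.2 (by simpa using hx)

theorem isSelfAdjoint_kerProj (T : E →L[ℂ] E) : IsSelfAdjoint (kerProj T) :=
  isSelfAdjoint_starProjection _

theorem norm_kerProj_le (T : E →L[ℂ] E) : ‖kerProj T‖ ≤ 1 :=
  Submodule.starProjection_norm_le _

theorem inner_kerProj (T : E →L[ℂ] E) (x : E) :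
    inner ℂ x (kerProj T x) = ((‖kerProj T x‖ ^ 2 : ℝ) : ℂ) := by
  have h1 : kerProj T (kerProj T x) = kerProj T x :=
    kerProj_apply_of_apply_eq_zero (apply_kerProj T x)
  have h : inner ℂ x (kerProj T x) = inner ℂ (kerProj T x) (kerProj T x) := by
    conv_lhs => rw [← h1]
    exact (Submodule.inner_starProjection_left_eq_right _ _ _).symm
  rw [h, inner_self_eq_norm_sq_to_K]
  norm_cast

theorem re_inner_kerProj (T : E →L[ℂ] E) (x : E) :
    (inner ℂ x (kerProj T x)).re = ‖kerProj T x‖ ^ 2 := by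
  rw [inner_kerProj, Complex.ofReal_re]

theorem inner_sub_kerProj (T : E →L[ℂ] E) (x w : E) (hw : T w = 0) :
    inner ℂ (x - kerProj T x) w = 0 :=
  Submodule.starProjection_inner_eq_zero x w (by simpa using hw)

theorem eq_kerProj_apply {T : E →L[ℂ] E} {x y : E} (hy : T y = 0)
    (h : ∀ w, T w = 0 → inner ℂ w (x - y) = 0) : kerProj T x = y :=
  Submodule.eq_starProjection_of_mem_orthogonal (by simpa using hy)
    ((Submodule.mem_orthogonal _ _).2 fun w hw => h w (by simpa using hw))

theorem inner_apply_of_isSelfAdjoint {T : E →L[ℂ] E} (hT : IsSelfAdjoint T) (x y : E) :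
    inner ℂ (T x) y = inner ℂ x (T y) := by
  conv_lhs => rw [← hT.adjoint_eq]
  exact ContinuousLinearMap.adjoint_inner_left T y x

/-- As `Z` is self-adjoint, `star U` commutes with it too. So `U` and `star U` both preserve the
kernel, and hence `U` preserves its orthogonal complement as well. -/
theorem kerProj_commute {Z U : E →L[ℂ] E} (hZ : IsSelfAdjoint Z) (h : Commute U Z) :
    Commute U (kerProj Z) := by
  have h1 (x : E) : U (Z x) = Z (U x) := DFunLike.congr_fun h x
  have h2 (x : E) : star U (Z x) = Z (star U x) := by
    have : star (U * Z) = star (Z * U) := congrArg star h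
    rw [star_mul, star_mul, hZ.star_eq] at this
    exact (DFunLike.congr_fun this x).symm
  ext x
  symm
  refine eq_kerProj_apply ?_ fun w hw => ?_
  · change Z (U (kerProj Z x)) = 0
    rw [← h1, apply_kerProj, map_zero]
  · change inner ℂ w (U x - U (kerProj Z x)) = 0
    rw [← map_sub, ← ContinuousLinearMap.adjoint_inner_left, ← inner_conj_symm]
    rw [inner_sub_kerProj, map_zero]
    rw [← ContinuousLinearMap.star_eq_adjoint, ← h2, hw, map_zero]

theorem kerProj_apply_apply {Z : E →L[ℂ] E} (hZ : IsSelfAdjoint Z) (x : E) :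
    kerProj Z (Z x) = 0 :=
  eq_kerProj_apply (map_zero Z) fun w hw => by
    rw [sub_zero, ← inner_apply_of_isSelfAdjoint hZ, hw, inner_zero_left]

/-- Since `a b = 0`, the orthogonal complements of the two kernels are orthogonal to each other,
each lying in the other kernel, and the kernels meet in the kernel of `a - b`. For `a`, `b` the
positive and negative parts of `T - t` this reads `χ_{(-∞,t]} + χ_{[t,∞)} = 1 + χ_{{t}}`. -/
theorem kerProj_add_kerProj {a b : E →L[ℂ] E} (ha : IsSelfAdjoint a) (hb : IsSelfAdjoint b)
    (hab : a * b = 0) : kerProj a + kerProj b = 1 + kerProj (a - b) := by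
  have hba : b * a = 0 := by
    have := congrArg star hab
    rwa [star_mul, ha.star_eq, hb.star_eq, star_zero] at this
  -- With `y = x - kerProj e x`, `‖c y‖² = ⟨y, c (c y)⟩`; here `c (c y)` lies in the kernel of `e`,
  -- to which `y` is orthogonal.
  have key (c e : E →L[ℂ] E) (hc : IsSelfAdjoint c) (hec : e * c = 0) (x : E) :
      c (x - kerProj e x) = 0 := by
    rw [← inner_self_eq_zero (𝕜 := ℂ), inner_apply_of_isSelfAdjoint hc]
    refine inner_sub_kerProj _ _ _ ?_
    exact DFunLike.congr_fun hec _
  have hker (w : E) (hw : (a - b) w = 0) : a w = 0 ∧ b w = 0 := by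
    have h1 : a w = b w := sub_eq_zero.1 hw
    have h2 : a w = 0 := by
      rw [← inner_self_eq_zero (𝕜 := ℂ), inner_apply_of_isSelfAdjoint ha]
      rw [h1, show a (b w) = 0 from DFunLike.congr_fun hab w, inner_zero_right]
    exact ⟨h2, h1 ▸ h2⟩
  ext x
  have h : kerProj (a - b) x = kerProj a x + kerProj b x - x := by
    refine eq_kerProj_apply ?_ fun w hw => ?_
    · have h1 := key a b ha hba x
      have h2 := key b a hb hab x
      have h3 := apply_kerProj a x
      have h4 := apply_kerProj b x
      rw [map_sub, sub_eq_zero] at h1 h2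
      simp [h1, h2, h3, h4]
    · obtain ⟨h1, h2⟩ := hker w hw
      rw [show x - (kerProj a x + kerProj b x - x) = (x - kerProj a x) + (x - kerProj b x) by abel,
        inner_add_right, ← inner_conj_symm, inner_sub_kerProj _ _ _ h1, ← inner_conj_symm,
        inner_sub_kerProj _ _ _ h2]
      simp
  simp [h]

/-- The regularized resolvent `(1 + n g(T))⁻¹`, which converges strongly to the projection onto
the kernel of `g(T)`. -/
def regularized (g : ℝ → ℝ) (T : E →L[ℂ] E) (n : ℕ) : E →L[ℂ] E :=
  cfc (fun u : ℝ => (1 + n * g u)⁻¹) T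

section Regularized

variable {g : ℝ → ℝ} {T : E →L[ℂ] E}

theorem continuous_regularizer (hg : Continuous g) (hg0 : ∀ u, 0 ≤ g u) (n : ℕ) :
    Continuous fun u : ℝ => (1 + n * g u)⁻¹ :=
  (by fun_prop : Continuous fun u => 1 + n * g u).inv₀ fun u => by
    have := hg0 u
    positivity

theorem regularized_add (hT : IsSelfAdjoint T) (hg : Continuous g) (hg0 : ∀ u, 0 ≤ g u) (n : ℕ) :
    regularized g T n + (n : ℝ) • (regularized g T n * cfc g T) = 1 := by
  have hc := continuous_regularizer hg hg0 n
  rw [regularized, ← cfc_mul _ _ T hc.continuousOn hg.continuousOn,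
    ← cfc_smul (n : ℝ) (fun u => (1 + n * g u)⁻¹ * g u) T (hc.mul hg).continuousOn,
    ← cfc_add (a := T) (fun u => (1 + n * g u)⁻¹) (fun u => (n : ℝ) • ((1 + n * g u)⁻¹ * g u))
      hc.continuousOn ((hc.mul hg).const_smul (n : ℝ)).continuousOn,
    ← cfc_one ℝ T]
  congr 1
  ext u
  have : 1 + n * g u ≠ 0 := by have := hg0 u; positivity
  simp only [smul_eq_mul, Pi.one_apply]
  field_simp

theorem norm_regularized_le (hg0 : ∀ u, 0 ≤ g u) (n : ℕ) : ‖regularized g T n‖ ≤ 1 := by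
  refine norm_cfc_le zero_le_one fun u _ => ?_
  have := hg0 u
  rw [Real.norm_of_nonneg (by positivity)]
  exact inv_le_one_of_one_le₀ (by nlinarith [mul_nonneg n.cast_nonneg this])

theorem isSelfAdjoint_regularized (n : ℕ) : IsSelfAdjoint (regularized g T n) :=
  cfc_predicate _ _

theorem regularized_apply_kerProj (hT : IsSelfAdjoint T) (hg : Continuous g)
    (hg0 : ∀ u, 0 ≤ g u) (n : ℕ) (x : E) :
    regularized g T n (kerProj (cfc g T) x) = kerProj (cfc g T) x := by
  have := DFunLike.congr_fun (regularized_add hT hg hg0 n) (kerProj (cfc g T) x)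
  simpa [apply_kerProj] using this

theorem norm_regularized_mul_le (hg : Continuous g) (hg0 : ∀ u, 0 ≤ g u) {n : ℕ} (hn : 0 < n) :
    ‖regularized g T n * cfc g T‖ ≤ 1 / n := by
  rw [regularized, ← cfc_mul _ _ T (continuous_regularizer hg hg0 n).continuousOn hg.continuousOn]
  refine norm_cfc_le (by positivity) fun u _ => ?_
  have := hg0 u
  rw [Real.norm_of_nonneg (by positivity), inv_mul_le_iff₀ (by positivity)]
  field_simp
  linarith

/-- The regularized operators fix the kernel of `g(T)`. On the range of `g(T)` they tend to zero at
rate `1/n`, and the uniform bound `1` extends this to the closure of the range, which is the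
orthogonal complement of the kernel. -/
theorem tendsto_regularized (hT : IsSelfAdjoint T) (hg : Continuous g) (hg0 : ∀ u, 0 ≤ g u)
    (x : E) : Tendsto (fun n => regularized g T n x) atTop (𝓝 (kerProj (cfc g T) x)) := by
  have hG : IsSelfAdjoint (cfc g T) := cfc_predicate _ _
  have hrange (z : E) : Tendsto (fun n => regularized g T n (cfc g T z)) atTop (𝓝 0) := by
    refine squeeze_zero_norm' (a := fun n : ℕ => 1 / (n : ℝ) * ‖z‖) ?_ ?_
    · filter_upwards [eventually_gt_atTop 0] with n hn
      exact ContinuousLinearMap.le_of_opNorm_le (regularized g T n * cfc g T)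
        (norm_regularized_mul_le hg hg0 hn) z
    · simpa using tendsto_one_div_atTop_nhds_zero_nat.mul_const ‖z‖
  have hclosure (y : E) (hy : y ∈ closure (Set.range (cfc g T : E →L[ℂ] E))) :
      Tendsto (fun n => regularized g T n y) atTop (𝓝 0) := by
    rw [Metric.tendsto_atTop]
    intro ε hε
    obtain ⟨_, ⟨z, rfl⟩, hz⟩ := Metric.mem_closure_iff.1 hy (ε / 2) (half_pos hε)
    obtain ⟨N, hN⟩ := Metric.tendsto_atTop.1 (hrange z) (ε / 2) (half_pos hε)
    refine ⟨N, fun n hn => ?_⟩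
    have h1 := hN n hn
    have h2 := ContinuousLinearMap.le_of_opNorm_le (regularized g T n)
      (norm_regularized_le hg0 n) (y - cfc g T z)
    rw [dist_zero_right] at h1 ⊢
    rw [dist_eq_norm] at hz
    calc ‖regularized g T n y‖
        = ‖regularized g T n (y - cfc g T z) + regularized g T n (cfc g T z)‖ := by
          rw [← map_add, sub_add_cancel]
      _ < ε := by
          refine (norm_add_le _ _).trans_lt ?_
          linarith
  have hmem : x - kerProj (cfc g T) x ∈ closure (Set.range (cfc g T : E →L[ℂ] E)) := by
    have h1 : x - kerProj (cfc g T) x ∈ (cfc g T).kerᗮ :=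
      Submodule.sub_starProjection_mem_orthogonal x
    rw [ContinuousLinearMap.orthogonal_ker, hG.adjoint_eq] at h1
    exact h1
  have h := (hclosure _ hmem).const_add (kerProj (cfc g T) x)
  rw [add_zero] at h
  refine h.congr fun n => ?_
  rw [map_sub, regularized_apply_kerProj hT hg hg0]
  abel

/-- The regularized operator is positive, is the identity on the kernel and has no cross terms with
its complement, so it dominates the kernel projection. -/
theorem re_inner_kerProj_le (hT : IsSelfAdjoint T) (hg : Continuous g) (hg0 : ∀ u, 0 ≤ g u)
    (n : ℕ) (x : E) :
    (inner ℂ x (kerProj (cfc g T) x)).re ≤ (inner ℂ x (regularized g T n x)).re := by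
  set P := kerProj (cfc g T)
  have h1 := regularized_apply_kerProj hT hg hg0 n x
  have hy : regularized g T n x = P x + regularized g T n (x - P x) := by
    rw [map_sub, h1]
    abel
  have hpos : 0 ≤ (inner ℂ (x - P x) (regularized g T n (x - P x))).re := by
    have h2 : 0 ≤ regularized g T n := cfc_nonneg fun u _ => by
      have := hg0 u
      positivity
    exact (ContinuousLinearMap.nonneg_iff_isPositive _).1 h2 |>.re_inner_nonneg_right _
  have hcross : inner ℂ (P x) (regularized g T n (x - P x)) = 0 := by
    rw [← inner_apply_of_isSelfAdjoint (isSelfAdjoint_regularized n), h1, ← inner_conj_symm,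
      inner_sub_kerProj _ _ _ (apply_kerProj _ _), map_zero]
  have hsplit : inner ℂ x (regularized g T n (x - P x))
      = inner ℂ (x - P x) (regularized g T n (x - P x)) := by
    rw [inner_sub_left, hcross, sub_zero]
  rw [hy, inner_add_right, Complex.add_re, hsplit]
  linarith

end Regularized

theorem kerProj_add_kerProj_eq {T : E →L[ℂ] E} (hT : IsSelfAdjoint T) (t : ℝ) :
    kerProj (cfc (fun u : ℝ => max (u - t) 0) T) + kerProj (cfc (fun u : ℝ => max (t - u) 0) T)
      = 1 + kerProj (T - algebraMap ℝ _ t) := by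
  have h1 : Continuous fun u : ℝ => max (u - t) 0 := by fun_prop
  have h2 : Continuous fun u : ℝ => max (t - u) 0 := by fun_prop
  rw [kerProj_add_kerProj (cfc_predicate _ _) (cfc_predicate _ _)]
  · congr 2
    rw [← cfc_sub _ _ T h1.continuousOn h2.continuousOn]
    conv_rhs => rw [← cfc_id' ℝ T, ← cfc_const (R := ℝ) t T]
    rw [← cfc_sub _ _ T]
    congr 1
    ext u
    rcases le_total u t with h | h
    · rw [max_eq_right (by linarith), max_eq_left (by linarith)]
      ring
    · rw [max_eq_left (by linarith), max_eq_right (by linarith)]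
      ring
  · rw [← cfc_mul _ _ T h1.continuousOn h2.continuousOn, ← cfc_zero ℝ T]
    congr 1
    ext u
    rcases le_total u t with h | h
    · rw [max_eq_right (by linarith)]
      simp
    · rw [max_eq_right (a := t - u) (by linarith)]
      simp

end

/-! ### Traces given by finite families of vectors, and rank-nullity -/

section

variable {E : Type*} [NormedAddCommGroup E] [InnerProductSpace ℂ E]

/-- The real part of `∑ i, ⟨v i, T v i⟩`. -/
def reTrace {ι : Type*} [Fintype ι] (v : ι → E) (T : E →L[ℂ] E) : ℝ :=
  ∑ i, (inner ℂ (v i) (T (v i))).re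

section reTrace

variable {ι : Type*} [Fintype ι] {v : ι → E}

theorem reTrace_add (S T : E →L[ℂ] E) : reTrace v (S + T) = reTrace v S + reTrace v T := by
  simp [reTrace, Finset.sum_add_distrib]

theorem reTrace_sub (S T : E →L[ℂ] E) : reTrace v (S - T) = reTrace v S - reTrace v T := by
  simp [reTrace, Finset.sum_sub_distrib]

theorem reTrace_smul (c : ℝ) (T : E →L[ℂ] E) : reTrace v (c • T) = c * reTrace v T := by
  simp [reTrace, inner_smul_right_eq_smul, Finset.mul_sum]

theorem reTrace_sum {κ : Type*} (s : Finset κ) (T : κ → E →L[ℂ] E) :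
    reTrace v (∑ k ∈ s, T k) = ∑ k ∈ s, reTrace v (T k) := by
  simp only [reTrace, _root_.sum_apply, inner_sum, Complex.re_sum]
  exact Finset.sum_comm

theorem reTrace_one (hv : ∀ i, ‖v i‖ = 1) : reTrace v 1 = Fintype.card ι := by
  simp [reTrace, inner_self_eq_norm_sq_to_K, hv]

theorem abs_re_inner_le (T : E →L[ℂ] E) {x : E} (hx : ‖x‖ = 1) :
    |(inner ℂ x (T x)).re| ≤ ‖T‖ :=
  calc |(inner ℂ x (T x)).re| ≤ ‖inner ℂ x (T x)‖ := Complex.abs_re_le_norm _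
    _ ≤ ‖x‖ * ‖T x‖ := norm_inner_le_norm _ _
    _ ≤ ‖T‖ := by simpa [hx] using T.le_opNorm x

theorem abs_reTrace_le (hv : ∀ i, ‖v i‖ = 1) (T : E →L[ℂ] E) :
    |reTrace v T| ≤ Fintype.card ι * ‖T‖ := by
  refine (Finset.abs_sum_le_sum_abs _ _).trans ?_
  refine (Finset.sum_le_sum fun i _ => abs_re_inner_le T (hv i)).trans ?_
  simp

theorem tendsto_reTrace {T : ℕ → E →L[ℂ] E} {S : E →L[ℂ] E}
    (h : ∀ x, Tendsto (fun n => T n x) atTop (𝓝 (S x))) :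
    Tendsto (fun n => reTrace v (T n)) atTop (𝓝 (reTrace v S)) :=
  tendsto_finsetSum _ fun i _ =>
    (Complex.continuous_re.tendsto _).comp ((tendsto_const_nhds.inner (h (v i))))

variable [CompleteSpace E]

theorem reTrace_kerProj (T : E →L[ℂ] E) : reTrace v (kerProj T) = ∑ i, ‖kerProj T (v i)‖ ^ 2 :=
  Finset.sum_congr rfl fun _ _ => re_inner_kerProj _ _

theorem reTrace_star_mul (T : E →L[ℂ] E) : reTrace v (star T * T) = ∑ i, ‖T (v i)‖ ^ 2 := by
  refine Finset.sum_congr rfl fun i _ => ?_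
  change (inner ℂ (v i) ((ContinuousLinearMap.adjoint T) (T (v i)))).re = _
  rw [ContinuousLinearMap.adjoint_inner_right, inner_self_eq_norm_sq_to_K]
  norm_cast

end reTrace

variable [CompleteSpace E]

/-- If the functional `∑ i, ⟨v i, · v i⟩` is tracial on the commutant of `𝒰`, then the trace of the
projection onto the closure of the range of `B` is at most the number of vectors `v i` that `B`
does not annihilate. -/
theorem card_sub_reTrace_kerProj_le {ι : Type*} [Fintype ι] {v : ι → E} (hv : ∀ i, ‖v i‖ = 1)
    {𝒰 : Set (E →L[ℂ] E)}
    (htr : ∀ Y : E →L[ℂ] E, (∀ U ∈ 𝒰, Commute U Y) →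
      ∑ i, ‖Y (v i)‖ ^ 2 = ∑ i, ‖star Y (v i)‖ ^ 2)
    {B : E →L[ℂ] E} (hB : ∀ U ∈ 𝒰, Commute U B) (hB' : ∀ U ∈ 𝒰, Commute U (star B))
    (J : Finset ι) (hJ : ∀ i ∉ J, B (v i) = 0) :
    reTrace v (1 - kerProj (B * star B)) ≤ J.card := by
  set Z := B * star B
  have hZ : IsSelfAdjoint Z := IsSelfAdjoint.mul_star_self B
  have hZ0 : 0 ≤ Z := mul_star_self_nonneg B
  -- The regularization asks for a function nonnegative on all of `ℝ`; as `Z ≥ 0`, this one still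
  -- gives `g(Z) = Z`.
  let g : ℝ → ℝ := fun u => max u 0
  have hg : Continuous g := by fun_prop
  have hg0 (u : ℝ) : 0 ≤ g u := le_max_right _ _
  have hgZ : cfc g Z = Z := by
    conv_rhs => rw [← cfc_id ℝ Z]
    exact cfc_congr fun u hu => max_eq_left (spectrum_nonneg_of_nonneg hZ0 hu)
  have hlim := tendsto_reTrace (v := v) (T := fun n => 1 - regularized g Z n)
    (S := 1 - kerProj Z) fun x => by
      have := tendsto_regularized hZ hg hg0 x
      rw [hgZ] at this
      simpa using this.const_sub x
  refine le_of_tendsto' hlim fun n => ?_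
  -- The square root makes `Y = y(Z) B` satisfy `Y Y* = n (1 + nZ)⁻¹ Z = 1 - (1 + nZ)⁻¹`, which
  -- increases to the range projection of `B`. So `Y` is a contraction approximating the partial
  -- isometry of the polar decomposition, and it vanishes wherever `B` does.
  let y : ℝ → ℝ := fun u => Real.sqrt (n * (1 + n * g u)⁻¹)
  have hc := continuous_regularizer hg hg0 n
  have hy : Continuous y := Real.continuous_sqrt.comp (continuous_const.mul hc)
  have hyZ : IsSelfAdjoint (cfc y Z) := cfc_predicate _ _
  let Y := cfc y Z * B
  have hsY : star Y = star B * cfc y Z := by rw [star_mul, hyZ.star_eq]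
  have hYY : Y * star Y = 1 - regularized g Z n := by
    rw [← regularized_add hZ hg hg0 n, add_sub_cancel_left, hsY]
    have h1 : Y * (star B * cfc y Z) = cfc y Z * Z * cfc y Z := by
      simp only [Y, Z, mul_assoc]
    have h2 : cfc y Z * Z = Z * cfc y Z := by
      have := (cfc_commute_cfc y id Z).eq
      rwa [cfc_id ℝ Z] at this
    rw [h1, h2, mul_assoc, ← cfc_mul y y Z hy.continuousOn hy.continuousOn, hgZ]
    have h3 : cfc (fun u => y u * y u) Z = (n : ℝ) • regularized g Z n := by
      rw [regularized, ← cfc_smul (n : ℝ) _ Z hc.continuousOn]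
      congr 1
      ext u
      have := hg0 u
      exact Real.mul_self_sqrt (by positivity)
    have h4 : Commute Z (regularized g Z n) :=
      (hZ.commute_cfc (Commute.refl Z) _).symm
    rw [h3, mul_smul_comm, h4.eq]
  have hYU : ∀ U ∈ 𝒰, Commute U Y := fun U hU =>
    ((hZ.commute_cfc ((hB U hU).mul_right (hB' U hU)).symm y).symm).mul_right (hB U hU)
  have hnorm : ‖Y‖ ≤ 1 := by
    have h1 : ‖Y * star Y‖ ≤ 1 := by
      rw [hYY, ← regularized_add hZ hg hg0 n, add_sub_cancel_left, regularized,
        ← cfc_mul _ _ Z hc.continuousOn hg.continuousOn,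
        ← cfc_smul (n : ℝ) (fun u => (1 + n * g u)⁻¹ * g u) Z (hc.mul hg).continuousOn]
      refine norm_cfc_le zero_le_one fun u _ => ?_
      have := hg0 u
      rw [Real.norm_of_nonneg (by positivity), smul_eq_mul, ← mul_assoc, mul_comm (n : ℝ),
        mul_assoc, inv_mul_le_iff₀ (by positivity)]
      linarith
    rw [CStarRing.norm_self_mul_star] at h1
    nlinarith [norm_nonneg Y]
  -- Traciality exchanges `Y Y*` for `Y* Y`, whose diagonal entries are at most `1` and vanish off
  -- `J`.
  have hfinal : reTrace v (1 - regularized g Z n) = ∑ i, ‖Y (v i)‖ ^ 2 := by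
    rw [htr Y hYU, ← reTrace_star_mul, star_star, hYY]
  rw [hfinal]
  classical
  calc ∑ i, ‖Y (v i)‖ ^ 2 ≤ ∑ i, if i ∈ J then (1 : ℝ) else 0 := by
        refine Finset.sum_le_sum fun i _ => ?_
        split_ifs with hi
        · have := Y.le_opNorm (v i)
          rw [hv i, mul_one] at this
          exact pow_le_one₀ (norm_nonneg _) (this.trans hnorm)
        · have : Y (v i) = 0 := by
            change cfc y Z (B (v i)) = 0
            rw [hJ i hi, map_zero]
          simp [this]
    _ = J.card := by simp

/-- If the trace `∑ i, ⟨v i, · v i⟩` is tracial on the commutant of `𝒰`, and `C T` annihilates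
all but few of the `v i` for a positive contraction `C`, then the kernel of `T` is almost as large
as the trace of `C`. -/
theorem reTrace_le_reTrace_kerProj_add {ι : Type*} [Fintype ι] {v : ι → E}
    (hv : ∀ i, ‖v i‖ = 1) {𝒰 : Set (E →L[ℂ] E)}
    (htr : ∀ Y : E →L[ℂ] E, (∀ U ∈ 𝒰, Commute U Y) →
      ∑ i, ‖Y (v i)‖ ^ 2 = ∑ i, ‖star Y (v i)‖ ^ 2)
    {T C : E →L[ℂ] E} (hT : IsSelfAdjoint T) (hTU : ∀ U ∈ 𝒰, Commute U T)
    (hC : 0 ≤ C) (hC1 : ‖C‖ ≤ 1) (hCU : ∀ U ∈ 𝒰, Commute U C)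
    (J : Finset ι) (hJ : ∀ i ∉ J, C (T (v i)) = 0) :
    reTrace v C ≤ reTrace v (kerProj T) + J.card := by
  have hCs : IsSelfAdjoint C := IsSelfAdjoint.of_nonneg hC
  let c := cfc Real.sqrt C
  have hcs : IsSelfAdjoint c := cfc_predicate _ _
  have hcc : c * c = C := by
    conv_rhs => rw [← cfc_id ℝ C]
    rw [← cfc_mul _ _ C Real.continuous_sqrt.continuousOn Real.continuous_sqrt.continuousOn]
    exact cfc_congr fun u hu => Real.mul_self_sqrt (spectrum_nonneg_of_nonneg hC hu)
  have hcU (U) (hU : U ∈ 𝒰) : Commute U c := (hCs.commute_cfc (hCU U hU).symm _).symm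
  have hc0 (x : E) (hx : C x = 0) : c x = 0 := by
    rw [← inner_self_eq_zero (𝕜 := ℂ), inner_apply_of_isSelfAdjoint hcs]
    rw [show c (c x) = C x from DFunLike.congr_fun hcc x, hx, inner_zero_right]
  have hc1 : ‖c‖ ≤ 1 := by
    have : ‖c * star c‖ ≤ 1 := by rwa [hcs.star_eq, hcc]
    rw [CStarRing.norm_self_mul_star] at this
    nlinarith [norm_nonneg c]
  -- With `c = √C`, `B` still kills `v i` off `J`, because `C` and `c` have the same kernel. Below,
  -- `M` projects onto the closure of the range of `B` and `N = 1 - M` onto the kernel of `star B =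
  -- T c`. The trace of `C` splits along `N` and `M`.
  let B := c * T
  have hsB : star B = T * c := by rw [star_mul, hcs.star_eq, hT.star_eq]
  have hBU (U) (hU : U ∈ 𝒰) : Commute U B := (hcU U hU).mul_right (hTU U hU)
  have hBU' (U) (hU : U ∈ 𝒰) : Commute U (star B) := hsB ▸ (hTU U hU).mul_right (hcU U hU)
  have hM := card_sub_reTrace_kerProj_le hv htr hBU hBU' J fun i hi => hc0 _ (hJ i hi)
  have hZ : IsSelfAdjoint (B * star B) := IsSelfAdjoint.mul_star_self B
  set N := kerProj (B * star B)
  have hN : IsSelfAdjoint N := isSelfAdjoint_kerProj _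
  have hNN : N * N = N := by
    ext x
    exact kerProj_apply_of_apply_eq_zero (apply_kerProj _ _)
  have hNU (U) (hU : U ∈ 𝒰) : Commute U N :=
    kerProj_commute hZ ((hBU U hU).mul_right (hBU' U hU))
  set M := 1 - N
  have hMs : IsSelfAdjoint M := (IsSelfAdjoint.one _).sub hN
  have hMU (U) (hU : U ∈ 𝒰) : Commute U M := (Commute.one_right U).sub_right (hNU U hU)
  have hMM : star M * M = M := by
    rw [hMs.star_eq]
    simp only [M, sub_mul, mul_sub, one_mul, mul_one, hNN]
    abel
  have hTcN (x : E) : T (c (N x)) = 0 := by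
    have h1 : B (star B (N x)) = 0 := apply_kerProj (B * star B) x
    have h2 : star B (N x) = 0 := by
      rw [← inner_self_eq_zero (𝕜 := ℂ)]
      nth_rw 1 [ContinuousLinearMap.star_eq_adjoint]
      rw [ContinuousLinearMap.adjoint_inner_left, h1, inner_zero_right]
    rwa [hsB] at h2
  -- On the range of `N`, `c` takes values in the kernel of `T`; this is the adjoint of that
  -- statement.
  have hNc : N * c = N * c * kerProj T := by
    have : c * N = kerProj T * (c * N) := by
      ext x
      exact (kerProj_apply_of_apply_eq_zero (hTcN x)).symm
    have h := congrArg star this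
    rwa [star_mul, star_mul, star_mul, hcs.star_eq, hN.star_eq,
      (isSelfAdjoint_kerProj T).star_eq] at h
  have hsplit (x : E) : ‖c x‖ ^ 2 = ‖N (c x)‖ ^ 2 + ‖M (c x)‖ ^ 2 := by
    have h : inner ℂ (M (c x)) (N (c x)) = 0 :=
      inner_sub_kerProj _ _ _ (apply_kerProj _ _)
    have h1 : c x = M (c x) + N (c x) := by simp [M]
    conv_lhs => rw [h1]
    have := norm_add_sq_eq_norm_sq_add_norm_sq_of_inner_eq_zero _ _ h
    nlinarith
  have hfirst : ∑ i, ‖N (c (v i))‖ ^ 2 ≤ reTrace v (kerProj T) := by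
    rw [reTrace_kerProj]
    refine Finset.sum_le_sum fun i _ => ?_
    rw [show N (c (v i)) = N (c (kerProj T (v i))) from DFunLike.congr_fun hNc (v i)]
    gcongr
    refine ((N.le_of_opNorm_le (norm_kerProj_le _)) _).trans ?_
    rw [one_mul]
    simpa using c.le_of_opNorm_le hc1 (kerProj T (v i))
  -- Traciality moves the contraction `c` to the left of `M`, where it can be dropped.
  have hsecond : ∑ i, ‖M (c (v i))‖ ^ 2 ≤ reTrace v M := by
    have h1 := htr (M * c) fun U hU => (hMU U hU).mul_right (hcU U hU)
    rw [star_mul, hcs.star_eq, hMs.star_eq] at h1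
    refine h1.le.trans ?_
    rw [show reTrace v M = reTrace v (star M * M) by rw [hMM], reTrace_star_mul]
    refine Finset.sum_le_sum fun i _ => ?_
    change ‖c (M (v i))‖ ^ 2 ≤ _
    gcongr
    simpa using c.le_of_opNorm_le hc1 (M (v i))
  have htotal : reTrace v C = ∑ i, ‖N (c (v i))‖ ^ 2 + ∑ i, ‖M (c (v i))‖ ^ 2 := by
    rw [← Finset.sum_add_distrib, ← Finset.sum_congr rfl fun i _ => hsplit (v i),
      ← reTrace_star_mul, hcs.star_eq, hcc]
  linarith

end

/-! ### From moments and eigenspace bounds to spectral distribution functions -/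

section

theorem norm_cfc_sub_aeval_le {E : Type*} [NormedAddCommGroup E] [InnerProductSpace ℂ E]
    [CompleteSpace E] {T : E →L[ℂ] E} (hT : IsSelfAdjoint T) {R : ℝ} (hTR : ‖T‖ ≤ R)
    {f : ℝ → ℝ} (hf : Continuous f) {q : Polynomial ℝ} {ε : ℝ} (hε : 0 ≤ ε)
    (hq : ∀ u ∈ Set.Icc (-R) R, |q.eval u - f u| ≤ ε) :
    ‖cfc f T - Polynomial.aeval T q‖ ≤ ε := by
  rw [← cfc_polynomial q T, ← cfc_sub _ _ T hf.continuousOn q.continuous.continuousOn]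
  refine norm_cfc_le hε fun u hu => ?_
  have h1 : ‖u‖ ≤ ‖T‖ := IsometricContinuousFunctionalCalculus.norm_spectrum_le T hu
  rw [norm_sub_rev]
  exact hq u (abs_le.1 (h1.trans hTR))

section Approximation

variable {F : Type*} [NormedAddCommGroup F] [InnerProductSpace ℂ F] [CompleteSpace F]
  {κ : Type*} [Fintype κ] {w : κ → F} {T : F →L[ℂ] F}
  {E : ℕ → Type*} [∀ m, NormedAddCommGroup (E m)] [∀ m, InnerProductSpace ℂ (E m)]
  [∀ m, CompleteSpace (E m)] {ι : ℕ → Type*} [∀ m, Fintype (ι m)] {v : ∀ m, ι m → E m}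
  {S : ∀ m, E m →L[ℂ] E m} {N : ℕ → ℝ} {R : ℝ}

/-- If the moments of `S m`, in the normalized traces, converge to those of `T`, then so do the
traces of all continuous functions. -/
theorem tendsto_reTrace_cfc (hw : ∀ i, ‖w i‖ = 1) (hv : ∀ m i, ‖v m i‖ = 1)
    (hT : IsSelfAdjoint T) (hS : ∀ m, IsSelfAdjoint (S m)) (hTR : ‖T‖ ≤ R)
    (hSR : ∀ m, ‖S m‖ ≤ R) (hN : ∀ m, 0 < N m)
    (hcard : ∀ m, (Fintype.card (ι m) : ℝ) = Fintype.card κ * N m)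
    (hmom : ∀ k : ℕ, Tendsto (fun m => reTrace (v m) (S m ^ k) / N m) atTop
      (𝓝 (reTrace w (T ^ k)))) {f : ℝ → ℝ} (hf : Continuous f) :
    Tendsto (fun m => reTrace (v m) (cfc f (S m)) / N m) atTop (𝓝 (reTrace w (cfc f T))) := by
  have hpoly (q : Polynomial ℝ) :
      Tendsto (fun m => reTrace (v m) (Polynomial.aeval (S m) q) / N m) atTop
        (𝓝 (reTrace w (Polynomial.aeval T q))) := by
    simp only [Polynomial.aeval_eq_sum_range, reTrace_sum, reTrace_smul, Finset.sum_div,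
      mul_div_assoc]
    exact tendsto_finsetSum _ fun k _ => (hmom k).const_mul _
  rw [Metric.tendsto_atTop]
  intro ε hε
  set D : ℝ := (Fintype.card κ : ℝ)
  have hD : 0 ≤ D := Nat.cast_nonneg _
  -- Each of the two polynomial approximations costs at most `D * η < ε / 3`; `D + 1` keeps the
  -- denominator nonzero when `D = 0`.
  set η := ε / (3 * (D + 1))
  have hη : 0 < η := by positivity
  have hDη : D * η < ε / 3 := by
    have : (D + 1) * η = ε / 3 := by
      simp only [η]
      field_simp
    nlinarith
  obtain ⟨q, hq⟩ := exists_polynomial_near_of_continuousOn (-R) R f hf.continuousOn η hη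
  obtain ⟨m₀, hm₀⟩ := Metric.tendsto_atTop.1 (hpoly q) (ε / 3) (by positivity)
  refine ⟨m₀, fun m hm => ?_⟩
  have h1 := hm₀ m hm
  have h2 : |reTrace (v m) (cfc f (S m)) / N m - reTrace (v m) (Polynomial.aeval (S m) q) / N m|
      ≤ D * η := by
    rw [← sub_div, ← reTrace_sub, abs_div, abs_of_pos (hN m), div_le_iff₀ (hN m)]
    refine (abs_reTrace_le (hv m) _).trans ?_
    rw [hcard m]
    have := norm_cfc_sub_aeval_le (hS m) (hSR m) hf hη.le fun u hu => (hq u hu).le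
    have h0 : 0 ≤ D * N m := mul_nonneg hD (hN m).le
    nlinarith [mul_le_mul_of_nonneg_left this h0]
  have h3 : |reTrace w (cfc f T) - reTrace w (Polynomial.aeval T q)| ≤ D * η := by
    rw [← reTrace_sub]
    refine (abs_reTrace_le hw _).trans ?_
    exact mul_le_mul_of_nonneg_left
      (norm_cfc_sub_aeval_le hT hTR hf hη.le fun u hu => (hq u hu).le) hD
  rw [Real.dist_eq] at h1 ⊢
  rw [abs_lt] at *
  rw [abs_le] at h2 h3
  constructor <;> linarith

/-- Upper semicontinuity: `n` is fixed first, so that the regularized trace of the limit is within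
`ε` of the kernel trace. Then `(1 + n g)⁻¹` is one continuous function, whose traces converge and
dominate the kernel traces of all the `S m`. -/
theorem eventually_reTrace_kerProj_le (hw : ∀ i, ‖w i‖ = 1) (hv : ∀ m i, ‖v m i‖ = 1)
    (hT : IsSelfAdjoint T) (hS : ∀ m, IsSelfAdjoint (S m)) (hTR : ‖T‖ ≤ R)
    (hSR : ∀ m, ‖S m‖ ≤ R) (hN : ∀ m, 0 < N m)
    (hcard : ∀ m, (Fintype.card (ι m) : ℝ) = Fintype.card κ * N m)
    (hmom : ∀ k : ℕ, Tendsto (fun m => reTrace (v m) (S m ^ k) / N m) atTop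
      (𝓝 (reTrace w (T ^ k)))) {g : ℝ → ℝ} (hg : Continuous g) (hg0 : ∀ u, 0 ≤ g u)
    {ε : ℝ} (hε : 0 < ε) :
    ∀ᶠ m in atTop, reTrace (v m) (kerProj (cfc g (S m))) / N m
      < reTrace w (kerProj (cfc g T)) + ε := by
  obtain ⟨n, hn⟩ := ((tendsto_reTrace (v := w) fun x =>
    tendsto_regularized hT hg hg0 x).eventually_lt_const
      (lt_add_of_pos_right _ hε)).exists
  have h := tendsto_reTrace_cfc hw hv hT hS hTR hSR hN hcard hmom
    (continuous_regularizer hg hg0 n)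
  filter_upwards [h.eventually_lt_const hn] with m hm
  refine lt_of_le_of_lt ?_ hm
  have := hN m
  gcongr
  exact Finset.sum_le_sum fun i _ => re_inner_kerProj_le (hS m) hg hg0 n (v m i)

/-- Convergence of moments together with lower semicontinuity of the dimensions of all
eigenspaces gives the pointwise convergence of spectral distribution functions. -/
theorem tendsto_reTrace_spectralProjection (hw : ∀ i, ‖w i‖ = 1) (hv : ∀ m i, ‖v m i‖ = 1)
    (hT : IsSelfAdjoint T) (hS : ∀ m, IsSelfAdjoint (S m)) (hTR : ‖T‖ ≤ R)
    (hSR : ∀ m, ‖S m‖ ≤ R) (hN : ∀ m, 0 < N m)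
    (hcard : ∀ m, (Fintype.card (ι m) : ℝ) = Fintype.card κ * N m)
    (hmom : ∀ k : ℕ, Tendsto (fun m => reTrace (v m) (S m ^ k) / N m) atTop
      (𝓝 (reTrace w (T ^ k))))
    (t : ℝ) {δ : ℕ → ℝ} (hδ : Tendsto δ atTop (𝓝 0))
    (hker : ∀ m, reTrace w (kerProj (T - algebraMap ℝ _ t))
      ≤ reTrace (v m) (kerProj (S m - algebraMap ℝ _ t)) / N m + δ m) :
    Tendsto (fun m => reTrace (v m) (spectralProjection (S m) t) / N m) atTop
      (𝓝 (reTrace w (spectralProjection T t))) := by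
  have hsum := congrArg (reTrace w) (kerProj_add_kerProj_eq hT t)
  rw [reTrace_add, reTrace_add, reTrace_one hw] at hsum
  have hsum' (m : ℕ) : reTrace (v m) (kerProj (cfc (fun u : ℝ => max (u - t) 0) (S m))) / N m
      + reTrace (v m) (kerProj (cfc (fun u : ℝ => max (t - u) 0) (S m))) / N m
      = Fintype.card κ + reTrace (v m) (kerProj (S m - algebraMap ℝ _ t)) / N m := by
    have := congrArg (reTrace (v m)) (kerProj_add_kerProj_eq (hS m) t)
    rw [reTrace_add, reTrace_add, reTrace_one (hv m), hcard m] at this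
    rw [← add_div, this, add_div, mul_div_cancel_right₀ _ (hN m).ne']
  simp only [spectralProjection_eq_kerProj]
  rw [Metric.tendsto_nhds]
  intro ε hε
  have h1 := eventually_reTrace_kerProj_le hw hv hT hS hTR hSR hN hcard hmom
    (g := fun u : ℝ => max (u - t) 0) (by fun_prop) (fun _ => le_max_right _ _) (half_pos hε)
  have h2 := eventually_reTrace_kerProj_le hw hv hT hS hTR hSR hN hcard hmom
    (g := fun u : ℝ => max (t - u) 0) (by fun_prop) (fun _ => le_max_right _ _) (half_pos hε)
  filter_upwards [h1, h2, hδ.eventually_lt_const (half_pos hε)] with m h1 h2 h3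
  have h4 := hsum' m
  have h5 := hker m
  -- The upper estimate is `h1`. For the lower one, `h4` and `hsum` express both lower distribution
  -- functions through the upper ones and the eigenspaces at `t`, which `h2` and `h5` control.
  rw [Real.dist_eq, abs_lt]
  constructor <;> linarith

end Approximation

end

/-! ### Word balls and Følner boundaries -/

section Folner

variable {Q : Type*} [Group Q]

theorem finite_setOf_wordLength_le {S : Finset Q} (hS : Subgroup.closure (S : Set Q) = ⊤) (n : ℕ) :
    {q | wordLength S q ≤ n}.Finite := by
  let S' : Set Q := (S : Set Q) ∪ (S : Set Q)⁻¹
  have hS' : S'.Finite := S.finite_toSet.union S.finite_toSet.inv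
  have : Finite S' := hS'
  refine ((List.finite_length_le S' n).image fun l => (l.map Subtype.val).prod).subset ?_
  intro q hq
  -- Generation matters here: the infimum of the empty set is `0`, so elements not represented by
  -- any word would lie in every ball.
  have hne : {k | ∃ l : List Q, l.length = k ∧ (∀ x ∈ l, x ∈ S ∨ x⁻¹ ∈ S) ∧ l.prod = q}.Nonempty := by
    have hmem : q ∈ (Subgroup.closure (S : Set Q)).toSubmonoid := by
      rw [hS]
      trivial
    rw [Subgroup.closure_toSubmonoid] at hmem
    obtain ⟨l, hl, hlq⟩ := Submonoid.exists_list_of_mem_closure hmem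
    exact ⟨_, l, rfl, fun x hx => by simpa using hl x hx, hlq⟩
  obtain ⟨l, hl, hlS, hlq⟩ := Nat.sInf_mem hne
  refine ⟨l.attach.map fun x => ⟨x.1, by simpa [S'] using hlS x.1 x.2⟩, ?_, ?_⟩
  · have : l.length ≤ n := hl.trans_le hq
    simpa using this
  · simpa using hlq

theorem finite_boundary {S : Finset Q} (hS : Subgroup.closure (S : Set Q) = ⊤) (δ : ℕ)
    (X : Finset Q) : (boundary S δ X).Finite := by
  refine ((finite_setOf_wordLength_le hS δ).mul X.finite_toSet).subset ?_
  rintro y ⟨-, x, hx, hxy⟩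
  exact ⟨y * x⁻¹, hxy, x, hx, by simp⟩

/-- The points of `X` that some element of `L` moves out of `X`. -/
def exitSet (L : Set Q) (X : Finset Q) : Finset Q := by
  classical exact X.filter fun x => ∃ q ∈ L, q * x ∉ X

theorem mem_exitSet {L : Set Q} {X : Finset Q} {x : Q} :
    x ∈ exitSet L X ↔ x ∈ X ∧ ∃ q ∈ L, q * x ∉ X := by
  simp [exitSet]

theorem mem_of_notMem_exitSet {L : Set Q} {X : Finset Q} {x : Q} (hx : x ∈ X)
    (h : x ∉ exitSet L X) {q : Q} (hq : q ∈ L) : q * x ∈ X := by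
  by_contra hqx
  exact h (mem_exitSet.2 ⟨hx, q, hq, hqx⟩)

/-- For each `q ∈ L`, the map `x ↦ q x` injects the points it moves out of `X` into the boundary of
width the largest word length in `L`. Finiteness of the boundary is needed because `ncard` of an
infinite set is `0`. -/
theorem card_exitSet_le {S : Finset Q} (hS : Subgroup.closure (S : Set Q) = ⊤) (L : Finset Q)
    (X : Finset Q) :
    (exitSet (L : Set Q) X).card ≤ L.card * (boundary S (L.sup (wordLength S)) X).ncard := by
  classical
  have hsub : exitSet (L : Set Q) X ⊆ L.biUnion fun q => X.filter fun x => q * x ∉ X := by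
    intro x hx
    obtain ⟨hxX, q, hq, hqx⟩ := mem_exitSet.1 hx
    exact Finset.mem_biUnion.2 ⟨q, hq, Finset.mem_filter.2 ⟨hxX, hqx⟩⟩
  refine (Finset.card_le_card hsub).trans (Finset.card_biUnion_le_card_mul _ _ _ fun q hq => ?_)
  rw [← Set.ncard_coe_finset]
  refine Set.ncard_le_ncard_of_injOn (fun x => q * x) (fun x hx => ?_)
    (fun x _ y _ h => mul_left_cancel h) (finite_boundary hS _ X)
  obtain ⟨hxX, hqx⟩ := Finset.mem_filter.1 hx
  refine ⟨hqx, x, hxX, ?_⟩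
  rw [wordDist, mul_inv_cancel_right]
  exact Finset.le_sup (f := wordLength S) hq

theorem IsFolner.tendsto_card_exitSet {S : Finset Q} (hS : Subgroup.closure (S : Set Q) = ⊤)
    {X : ℕ → Finset Q} (hX : IsFolner S X) {L : Set Q} (hL : L.Finite) :
    Tendsto (fun m => ((exitSet L (X m)).card : ℝ) / (X m).card) atTop (𝓝 0) := by
  obtain ⟨L, rfl⟩ := hL.exists_finset_coe
  refine squeeze_zero (fun m => by positivity) (fun m => ?_)
    (by simpa using (hX.tendsto (L.sup (wordLength S))).const_mul (L.card : ℝ))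
  rw [← mul_div_assoc]
  gcongr
  exact_mod_cast card_exitSet_le hS L (X m)

end Folner

/-! ### Magnetic translations and twisted left multiplication -/

section Operators

variable {G : Type*} {d : ℕ}

theorem matrixAction_apply (M : Matrix (Fin d) (Fin d) ℂ) (f : L2 G d) (x : G) :
    matrixAction G M f x = Matrix.toEuclideanCLM (𝕜 := ℂ) M (f x) := rfl

theorem inner_delta (g : G) (a : Fin d) (f : L2 G d) : inner ℂ (delta g a) f = f g a := by
  classical
  unfold delta
  rw [lp.inner_single_left, EuclideanSpace.inner_single_left]
  simp

theorem norm_delta (g : G) (a : Fin d) : ‖(delta g a : L2 G d)‖ = 1 := by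
  classical
  unfold delta
  rw [lp.norm_single (by simp)]
  simp

theorem delta_apply_self (g : G) (a : Fin d) :
    (delta g a : L2 G d) g = EuclideanSpace.single a 1 := by
  simp [delta]

theorem delta_apply_of_ne {g x : G} (h : x ≠ g) (a : Fin d) : (delta g a : L2 G d) x = 0 := by
  simp [delta, h]

variable [Group G]

theorem leftTranslation_apply (σ : Multiplier G) (g : G) (f : L2 G d) (x : G) :
    leftTranslation σ d g f x = (σ.toFun g (g⁻¹ * x) : ℂ) • f (g⁻¹ * x) := rfl

theorem rightTranslation_apply (σ : Multiplier G) (g : G) (f : L2 G d) (x : G) :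
    rightTranslation σ d g f x = (σ.toFun x g : ℂ) • f (x * g) := rfl

theorem leftMul_apply {σ : Multiplier G} (A : Matrix (Fin d) (Fin d) (TwistedGroupAlgebra σ))
    (f : L2 G d) (x : G) :
    leftMul A f x = ∑ g ∈ matrixSupport A, Matrix.toEuclideanCLM (𝕜 := ℂ) (coeffMatrix A g)
      ((σ.toFun g (g⁻¹ * x) : ℂ) • f (g⁻¹ * x)) := by
  rw [leftMul, _root_.sum_apply, lp.coeFn_sum, Finset.sum_apply]
  rfl

theorem rightTranslation_delta (σ : Multiplier G) (g h : G) (a : Fin d) :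
    rightTranslation σ d h (delta g a) = (σ.toFun (g * h⁻¹) h : ℂ) • delta (g * h⁻¹) a := by
  ext1
  funext x
  rw [rightTranslation_apply, lp.coeFn_smul, Pi.smul_apply]
  by_cases hx : x = g * h⁻¹
  · subst hx
    rw [inv_mul_cancel_right, delta_apply_self, delta_apply_self]
  · rw [delta_apply_of_ne hx, delta_apply_of_ne fun h' => hx (eq_mul_inv_of_mul_eq h'), smul_zero,
      smul_zero]

/-- Left and right magnetic translations commute. -/
theorem rightTranslation_leftTranslation (σ : Multiplier G) (g k : G) (f : L2 G d) :
    rightTranslation σ.conj d g (leftTranslation σ d k f)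
      = leftTranslation σ d k (rightTranslation σ.conj d g f) := by
  ext1
  funext x
  simp only [rightTranslation_apply, leftTranslation_apply, smul_smul, Multiplier.conj, mul_assoc]
  congr 1
  -- The cocycle identity at this triple equates the phases of the two orders of translation.
  have h := σ.cocycle k (k⁻¹ * x) g
  rw [mul_inv_cancel_left, mul_assoc] at h
  rw [← Circle.coe_mul, ← Circle.coe_mul]
  congr 1
  have key (a b c e : Circle) (h : a * b = c * e) : c⁻¹ * b = e * a⁻¹ := by
    rw [inv_mul_eq_iff_eq_mul, ← mul_assoc, eq_mul_inv_iff_mul_eq, mul_comm b, h]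
  exact key _ _ _ _ h

theorem mem_centralizer_iff_commute {E : Type*} [NormedAddCommGroup E] [InnerProductSpace ℂ E]
    {𝒰 : Set (E →L[ℂ] E)} {T : E →L[ℂ] E} :
    T ∈ Subalgebra.centralizer ℂ 𝒰 ↔ ∀ U ∈ 𝒰, Commute U T :=
  Subalgebra.mem_centralizer_iff ℂ

theorem spectralProjection_mem_centralizer {E : Type*} [NormedAddCommGroup E]
    [InnerProductSpace ℂ E] [CompleteSpace E] {𝒰 : Set (E →L[ℂ] E)} {T : E →L[ℂ] E}
    (hT : IsSelfAdjoint T) (h : T ∈ Subalgebra.centralizer ℂ 𝒰) (t : ℝ) :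
    spectralProjection T t ∈ Subalgebra.centralizer ℂ 𝒰 := by
  rw [mem_centralizer_iff_commute] at h ⊢
  exact fun U hU => kerProj_commute (cfc_predicate _ _) (hT.commute_cfc (h U hU).symm _).symm

theorem matrixAction_comp_leftTranslation_mem_twistedVN (σ : Multiplier G)
    (M : Matrix (Fin d) (Fin d) ℂ) (k : G) :
    matrixAction G M ∘L leftTranslation σ d k ∈ twistedVN σ d := by
  refine mem_centralizer_iff_commute.2 ?_
  rintro _ ⟨g, rfl⟩
  refine ContinuousLinearMap.ext fun f => ?_
  change rightTranslation σ.conj d g (matrixAction G M (leftTranslation σ d k f))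
    = matrixAction G M (leftTranslation σ d k (rightTranslation σ.conj d g f))
  rw [← rightTranslation_leftTranslation]
  ext1
  funext x
  rw [rightTranslation_apply, matrixAction_apply, matrixAction_apply, rightTranslation_apply,
    map_smul]

theorem leftMul_mem_twistedVN {σ : Multiplier G}
    (A : Matrix (Fin d) (Fin d) (TwistedGroupAlgebra σ)) : leftMul A ∈ twistedVN σ d := by
  unfold leftMul
  exact Subalgebra.sum_mem _ fun k _ => matrixAction_comp_leftTranslation_mem_twistedVN σ _ k

/-- The diagonal coefficients of an element of the twisted von Neumann algebra are constant. -/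
theorem apply_delta_apply {σ : Multiplier G} {T : L2 G d →L[ℂ] L2 G d} (hT : T ∈ twistedVN σ d)
    (g : G) (a b : Fin d) : T (delta g a) g b = T (delta 1 a) 1 b := by
  have h := DFunLike.congr_fun
    (mem_centralizer_iff_commute.1 hT _ ⟨g, rfl⟩).eq (delta g a : L2 G d)
  change rightTranslation σ.conj d g (T (delta g a)) = T (rightTranslation σ.conj d g (delta g a))
    at h
  -- Translation by `g` carries `δ_g` to `δ_1` with phase `σ.conj(1, g) = 1`, so normalization of
  -- the multiplier removes the twist from the diagonal.
  rw [rightTranslation_delta, mul_inv_cancel, σ.conj.one_left, Circle.coe_one, one_smul] at h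
  rw [← h, rightTranslation_apply, σ.conj.one_left]
  simp

/-- Finite propagation: the value at `g` involves only the points `k⁻¹ g` with `k` in the support of
`A`. -/
theorem leftMul_apply_eq_zero {σ : Multiplier G} {Q : Type*} [Group Q] (p : G →* Q)
    (A : Matrix (Fin d) (Fin d) (TwistedGroupAlgebra σ)) {K : Set Q}
    (hK : ∀ g ∈ matrixSupport A, p g ∈ K) {Y : Set Q} {f : L2 G d}
    (hf : ∀ g, p g ∉ Y → f g = 0) (g : G) (hg : ∀ q ∈ K, q⁻¹ * p g ∉ Y) : leftMul A f g = 0 := by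
  rw [leftMul_apply]
  refine Finset.sum_eq_zero fun k hk => ?_
  rw [hf (k⁻¹ * g) (by simpa using hg _ (hK k hk)), smul_zero, map_zero]

end Operators

/-! ### Truncations and the trace on the `H`-equivariant algebra -/

section Truncation

variable {G : Type*} {d : ℕ}

theorem ofReal_norm_sq_eq_tsum (f : L2 G d) :
    ENNReal.ofReal (‖f‖ ^ 2) = ∑' g, ENNReal.ofReal (‖f g‖ ^ 2) := by
  have h := lp.hasSum_norm (p := 2) (by simp) f
  simp only [ENNReal.toReal_ofNat, Real.rpow_ofNat] at h
  rw [← h.tsum_eq, ENNReal.ofReal_tsum_of_nonneg (fun _ => by positivity) h.summable]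

variable [Group G] {H : Subgroup G} {X : Finset (G ⧸ H)}

theorem orthogonalProjection_supportedOn_apply (f : L2 G d) {g : G} (hg : (g : G ⧸ H) ∈ X) :
    ((supportedOn H d X).orthogonalProjectionOnto f : L2 G d) g = f g := by
  ext a
  rw [← inner_delta, ← inner_delta]
  change inner ℂ (delta g a) ((supportedOn H d X).starProjection f) = _
  rw [← Submodule.inner_starProjection_left_eq_right,
    Submodule.starProjection_eq_self_iff.2 (delta_mem H X g hg a)]

theorem truncation_apply (T : L2 G d →L[ℂ] L2 G d) (f : supportedOn H d X) {g : G}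
    (hg : (g : G ⧸ H) ∈ X) : (truncation H X T f : L2 G d) g = T f g :=
  orthogonalProjection_supportedOn_apply _ hg

theorem coe_truncation_of_mem (T : L2 G d →L[ℂ] L2 G d) {f : supportedOn H d X}
    (h : T f ∈ supportedOn H d X) : (truncation H X T f : L2 G d) = T f :=
  Submodule.starProjection_eq_self_iff.2 h

theorem supportedOn_ext {f₁ f₂ : supportedOn H d X}
    (h : ∀ g : G, (g : G ⧸ H) ∈ X → (f₁ : L2 G d) g = (f₂ : L2 G d) g) : f₁ = f₂ := by
  ext1
  ext1
  funext g
  by_cases hg : (g : G ⧸ H) ∈ X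
  · exact h g hg
  · rw [f₁.2 g hg, f₂.2 g hg]

theorem inner_truncation (T : L2 G d →L[ℂ] L2 G d) (f₁ f₂ : supportedOn H d X) :
    inner ℂ f₁ (truncation H X T f₂) = inner ℂ (f₁ : L2 G d) (T f₂) := by
  change inner ℂ (f₁ : L2 G d) ((supportedOn H d X).starProjection (T f₂)) = _
  rw [← Submodule.inner_starProjection_left_eq_right,
    Submodule.starProjection_eq_self_iff.2 f₁.2]

theorem isSelfAdjoint_truncation {T : L2 G d →L[ℂ] L2 G d} (hT : IsSelfAdjoint T) :
    IsSelfAdjoint (truncation H X T) := by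
  rw [ContinuousLinearMap.isSelfAdjoint_iff_isSymmetric]
  intro f₁ f₂
  change inner ℂ (truncation H X T f₁) f₂ = inner ℂ f₁ (truncation H X T f₂)
  refine (inner_conj_symm (𝕜 := ℂ) (truncation H X T f₁) f₂).symm.trans ?_
  rw [inner_truncation, inner_truncation]
  exact (inner_conj_symm _ _).trans (inner_apply_of_isSelfAdjoint hT _ _)

theorem norm_truncation_le (T : L2 G d →L[ℂ] L2 G d) : ‖truncation H X T‖ ≤ ‖T‖ := by
  refine ContinuousLinearMap.opNorm_le_bound _ (norm_nonneg _) fun f => ?_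
  calc ‖truncation H X T f‖ = ‖(supportedOn H d X).starProjection (T f)‖ := rfl
    _ ≤ ‖T f‖ := by
      simpa using (supportedOn H d X).starProjection.le_of_opNorm_le
        (Submodule.starProjection_norm_le _) (T f)
    _ ≤ ‖T‖ * ‖f‖ := T.le_opNorm f

theorem truncation_kerProj_nonneg (T : L2 G d →L[ℂ] L2 G d) : 0 ≤ truncation H X (kerProj T) := by
  rw [ContinuousLinearMap.nonneg_iff_isPositive, ContinuousLinearMap.isPositive_def']
  refine ⟨isSelfAdjoint_truncation (isSelfAdjoint_kerProj T), fun f => ?_⟩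
  rw [ContinuousLinearMap.reApplyInnerSelf_apply, inner_re_symm, inner_truncation, inner_kerProj]
  change 0 ≤ (((‖kerProj T f‖ ^ 2 : ℝ) : ℂ)).re
  rw [Complex.ofReal_re]
  positivity

/-- A multiplier pulled back from `G/H` is trivial when its second argument lies in `H`, so the
magnetic translations by `H` are the ordinary ones. These preserve `p⁻¹(X)`, hence commute with
cutting down to it. -/
theorem truncation_mem_equivariantAlgebra [H.Normal] {σ' : Multiplier (G ⧸ H)}
    {T : L2 G d →L[ℂ] L2 G d} (hT : T ∈ twistedVN (σ'.pullback (QuotientGroup.mk' H)) d) :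
    truncation H X T ∈ equivariantAlgebra H d X := by
  refine mem_centralizer_iff_commute.2 ?_
  rintro _ ⟨h, rfl⟩
  have hR : rightTranslation (σ'.pullback (QuotientGroup.mk' H)).conj d (h : G)
      = rightTranslation (Multiplier.trivial G) d (h : G) := by
    refine ContinuousLinearMap.ext fun f => ?_
    ext1
    funext x
    rw [rightTranslation_apply, rightTranslation_apply]
    have h1 : QuotientGroup.mk' H (h : G) = 1 := (QuotientGroup.eq_one_iff _).2 h.2
    congr 1
    change (((σ'.toFun (QuotientGroup.mk' H x) (QuotientGroup.mk' H h))⁻¹ : Circle) : ℂ)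
      = ((1 : Circle) : ℂ)
    rw [h1, σ'.one_right, inv_one]
  have hcomm := mem_centralizer_iff_commute.1 hT _ ⟨(h : G), rfl⟩
  rw [hR] at hcomm
  refine ContinuousLinearMap.ext fun f => supportedOn_ext fun g hg => ?_
  have hgh : ((g * h : G) : G ⧸ H) ∈ X := by rwa [QuotientGroup.mk_mul_of_mem g h.2]
  change rightTranslation (Multiplier.trivial G) d (h : G) (truncation H X T f : L2 G d) g
    = (truncation H X T (rightTranslationOn H d X h f) : L2 G d) g
  rw [truncation_apply _ _ hg, rightTranslation_apply, truncation_apply _ _ hgh]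
  have := DFunLike.congr_fun hcomm.eq (f : L2 G d)
  exact congrArg (fun k : L2 G d => k g) this

/-- The orthonormal family `δ_{s(x)} ⊗ e_a`, `x ∈ X`, of `l²(p⁻¹(X))^d`. -/
def sectionFamily (s : G ⧸ H → G) (hs : ∀ q : G ⧸ H, (s q : G ⧸ H) = q) (X : Finset (G ⧸ H))
    (i : X × Fin d) : supportedOn H d X :=
  ⟨delta (s i.1) i.2, delta_mem H X (s i.1) ((hs i.1).symm ▸ i.1.2) i.2⟩

variable {s : G ⧸ H → G} {hs : ∀ q : G ⧸ H, (s q : G ⧸ H) = q}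

theorem norm_sectionFamily (i : X × Fin d) : ‖sectionFamily s hs X i‖ = 1 := norm_delta _ _

theorem inner_sectionFamily (i : X × Fin d) (f : supportedOn H d X) :
    inner ℂ (sectionFamily s hs X i) f = (f : L2 G d) (s i.1) i.2 := inner_delta _ _ _

/-- Diagonal entries of a projection are squared norms, hence real, so the complex-valued trace
reduces to `reTrace`. -/
theorem truncTrace_kerProj (B : supportedOn H d X →L[ℂ] supportedOn H d X) :
    truncTrace H s hs X (kerProj B)
      = ((reTrace (sectionFamily s hs X) (kerProj B) / X.card : ℝ) : ℂ) := by
  have h : ∑ a : Fin d, ∑ x ∈ X.attach,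
      ((kerProj B ⟨delta (s x) a, delta_mem H X (s x) ((hs x).symm ▸ x.2) a⟩ : L2 G d) :
        G → EuclideanSpace ℂ (Fin d)) (s x) a
      = ((∑ i, ‖kerProj B (sectionFamily s hs X i)‖ ^ 2 : ℝ) : ℂ) := by
    rw [Complex.ofReal_sum, Fintype.sum_prod_type, Finset.sum_comm]
    refine Finset.sum_congr rfl fun x _ => Finset.sum_congr rfl fun a _ => ?_
    rw [← inner_kerProj, inner_sectionFamily]
    rfl
  rw [truncTrace, h, reTrace_kerProj]
  push_cast
  ring

theorem vnTrace_kerProj (T : L2 G d →L[ℂ] L2 G d) :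
    vnTrace (kerProj T) = ((reTrace (delta (1 : G)) (kerProj T) : ℝ) : ℂ) := by
  rw [reTrace_kerProj, vnTrace, Complex.ofReal_sum]
  refine Finset.sum_congr rfl fun a _ => ?_
  rw [← inner_kerProj, inner_delta]

/-- The decomposition of `G` into cosets of `H`, given by a section of `G → G/H`. -/
def sectionEquiv (s : G ⧸ H → G) (hs : ∀ q : G ⧸ H, (s q : G ⧸ H) = q) : (G ⧸ H) × H ≃ G where
  toFun z := s z.1 * z.2
  invFun g := (g, ⟨(s g)⁻¹ * g, QuotientGroup.eq.1 (hs g)⟩)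
  left_inv := by
    rintro ⟨q, h⟩
    have h1 : ((s q * h : G) : G ⧸ H) = q := by rw [QuotientGroup.mk_mul_of_mem _ h.2, hs]
    ext1
    · exact h1
    · ext1
      simp [h1]
  right_inv g := by simp

theorem ofReal_norm_sq_eq_sum (s : G ⧸ H → G) (hs : ∀ q : G ⧸ H, (s q : G ⧸ H) = q)
    (f : supportedOn H d X) :
    ENNReal.ofReal (‖f‖ ^ 2)
      = ∑ i : X × Fin d, ∑' h : H, ENNReal.ofReal (‖(f : L2 G d) (s i.1 * h) i.2‖ ^ 2) := by
  change ENNReal.ofReal (‖(f : L2 G d)‖ ^ 2) = _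
  rw [ofReal_norm_sq_eq_tsum, ← (sectionEquiv s hs).tsum_eq,
    ENNReal.tsum_prod (f := fun q h => ENNReal.ofReal (‖(f : L2 G d) (sectionEquiv s hs (q, h))‖ ^ 2)),
    tsum_eq_sum (s := X), ← Finset.sum_coe_sort, Fintype.sum_prod_type]
  · refine Finset.sum_congr rfl fun x _ => ?_
    rw [← Summable.tsum_finsetSum fun _ _ => ENNReal.summable]
    refine tsum_congr fun h => ?_
    rw [EuclideanSpace.norm_sq_eq, ENNReal.ofReal_sum_of_nonneg fun _ _ => by positivity]
    rfl
  · intro q hq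
    rw [ENNReal.tsum_eq_zero]
    intro h
    have h1 : ((sectionEquiv s hs (q, h) : G) : G ⧸ H) ∉ X := by
      change ((s q * h : G) : G ⧸ H) ∉ X
      rwa [QuotientGroup.mk_mul_of_mem _ h.2, hs]
    simp [f.2 _ h1]

/-- By equivariance the matrix entry of `Y` at `(s_j h, s_i)` equals that at `(s_j, s_i h⁻¹)`, which
is the conjugate of the transposed entry of `star Y`. -/
theorem equivariantAlgebra_apply_sectionFamily {Y : supportedOn H d X →L[ℂ] supportedOn H d X}
    (hY : ∀ U ∈ Set.range (rightTranslationOn H d X), Commute U Y) (i j : X × Fin d) (h : H) :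
    (Y (sectionFamily s hs X i) : L2 G d) (s j.1 * h) j.2
      = (starRingEnd ℂ) ((star Y (sectionFamily s hs X j) : L2 G d) (s i.1 * (h⁻¹ : H)) i.2) := by
  have hmem : ((s i.1 * (h⁻¹ : H) : G) : G ⧸ H) ∈ X := by
    rw [QuotientGroup.mk_mul_of_mem _ (h⁻¹).2, hs]
    exact i.1.2
  let e : supportedOn H d X := ⟨delta (s i.1 * (h⁻¹ : H)) i.2, delta_mem H X _ hmem i.2⟩
  have hinner (f : supportedOn H d X) :
      inner ℂ e f = (f : L2 G d) (s i.1 * (h⁻¹ : H)) i.2 := inner_delta _ _ _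
  have htrans : rightTranslationOn H d X h (sectionFamily s hs X i) = e := by
    ext1
    change rightTranslation (Multiplier.trivial G) d (h : G) (delta (s i.1) i.2)
      = delta (s i.1 * (h⁻¹ : H)) i.2
    rw [rightTranslation_delta]
    simp [Multiplier.trivial]
  have h1 : (Y (sectionFamily s hs X i) : L2 G d) (s j.1 * h)
      = (rightTranslationOn H d X h (Y (sectionFamily s hs X i)) : L2 G d) (s j.1) := by
    change _ = rightTranslation (Multiplier.trivial G) d (h : G)
      (Y (sectionFamily s hs X i) : L2 G d) (s j.1)
    rw [rightTranslation_apply]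
    simp [Multiplier.trivial]
  have h2 : rightTranslationOn H d X h (Y (sectionFamily s hs X i)) = Y e := by
    rw [← htrans]
    exact DFunLike.congr_fun (hY _ ⟨h, rfl⟩).eq _
  rw [h1, h2, ← inner_sectionFamily (hs := hs), ← hinner]
  refine Eq.trans ?_ (inner_conj_symm (𝕜 := ℂ) (star Y (sectionFamily s hs X j)) e).symm
  rw [ContinuousLinearMap.star_eq_adjoint, ContinuousLinearMap.adjoint_inner_left]

/-- The trace on `B(l²(p⁻¹(X))^d)^H` is tracial. -/
theorem sum_norm_sq_sectionFamily {Y : supportedOn H d X →L[ℂ] supportedOn H d X}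
    (hY : ∀ U ∈ Set.range (rightTranslationOn H d X), Commute U Y) :
    ∑ i, ‖Y (sectionFamily s hs X i)‖ ^ 2 = ∑ i, ‖star Y (sectionFamily s hs X i)‖ ^ 2 := by
  -- In `ENNReal` the sums over `H` need no summability. Both sides become sums of squared matrix
  -- entries over `i`, `j` and `H`, matched by exchanging `i` with `j` and `h` with `h⁻¹`.
  rw [← ENNReal.ofReal_eq_ofReal_iff (by positivity) (by positivity),
    ENNReal.ofReal_sum_of_nonneg fun _ _ => by positivity,
    ENNReal.ofReal_sum_of_nonneg fun _ _ => by positivity]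
  simp only [ofReal_norm_sq_eq_sum s hs]
  rw [Finset.sum_comm]
  refine Finset.sum_congr rfl fun j _ => Finset.sum_congr rfl fun i _ => ?_
  rw [← (Equiv.inv H).tsum_eq]
  refine tsum_congr fun h => ?_
  rw [equivariantAlgebra_apply_sectionFamily hY, RCLike.norm_conj]
  simp

end Truncation

/-! ### Moments and eigenspaces of truncations along a Følner sequence -/

open scoped Pointwise

section Exhaustion

variable {G : Type*} [Group G] {H : Subgroup G} {d : ℕ} {σ : Multiplier G}
  {s : G ⧸ H → G} {hs : ∀ q : G ⧸ H, (s q : G ⧸ H) = q}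

theorem re_inner_sectionFamily_of_eq {X : Finset (G ⧸ H)}
    {B : supportedOn H d X →L[ℂ] supportedOn H d X} {T : L2 G d →L[ℂ] L2 G d}
    (hT : T ∈ twistedVN σ d) (i : X × Fin d)
    (h : (B (sectionFamily s hs X i) : L2 G d) (s i.1) = T (delta (s i.1) i.2) (s i.1)) :
    (inner ℂ (sectionFamily s hs X i) (B (sectionFamily s hs X i))).re
      = (inner ℂ (delta (1 : G) i.2) (T (delta 1 i.2))).re := by
  rw [inner_delta, ← apply_delta_apply hT (s i.1), ← h]
  exact congrArg Complex.re (inner_sectionFamily i _)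

theorem sum_re_inner_delta (T : L2 G d →L[ℂ] L2 G d) (X : Finset (G ⧸ H)) :
    ∑ i : X × Fin d, (inner ℂ (delta (1 : G) i.2) (T (delta 1 i.2))).re
      = X.card * reTrace (delta (1 : G)) T := by
  rw [Fintype.sum_prod_type]
  simp [reTrace]

/-- Truncation leaves diagonal entries unchanged, and those of `T` are constant along `G`. There is
no boundary error and no propagation condition, so this applies to eigenprojections of `A`. -/
theorem reTrace_truncation_of_mem_twistedVN {T : L2 G d →L[ℂ] L2 G d} (hT : T ∈ twistedVN σ d)
    (X : Finset (G ⧸ H)) :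
    reTrace (sectionFamily s hs X) (truncation H X T) = X.card * reTrace (delta (1 : G)) T := by
  rw [← sum_re_inner_delta]
  refine Finset.sum_congr rfl fun i _ => re_inner_sectionFamily_of_eq hT i ?_
  exact truncation_apply T _ ((hs i.1).symm ▸ i.1.2)

variable [H.Normal]

/-- The image in `G/H` of the support of `A`, together with `1`. -/
def propagationSet (H : Subgroup G) [H.Normal]
    (A : Matrix (Fin d) (Fin d) (TwistedGroupAlgebra σ)) : Set (G ⧸ H) :=
  insert 1 ((fun g : G => (g : G ⧸ H)) '' matrixSupport A)

theorem finite_propagationSet_pow (A : Matrix (Fin d) (Fin d) (TwistedGroupAlgebra σ)) (k : ℕ) :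
    (propagationSet H A ^ k).Finite := by
  have h : (propagationSet H A).Finite := ((matrixSupport A).finite_toSet.image _).insert _
  induction k with
  | zero => simp
  | succ k ih => exact pow_succ (propagationSet H A) k ▸ ih.mul h

theorem leftMul_pow_delta_apply (A : Matrix (Fin d) (Fin d) (TwistedGroupAlgebra σ)) (k : ℕ)
    (g : G) (a : Fin d) (x : G) (hx : ∀ q ∈ propagationSet H A ^ k, q * (g : G ⧸ H) ≠ x) :
    (leftMul A ^ k) (delta g a) x = 0 := by
  induction k generalizing x with
  | zero =>
    refine delta_apply_of_ne (fun h => hx 1 (by simp) ?_) a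
    rw [h, one_mul]
  | succ k ih =>
    rw [pow_succ']
    refine leftMul_apply_eq_zero (QuotientGroup.mk' H) A (K := propagationSet H A)
      (fun k hk => Or.inr ⟨k, hk, rfl⟩)
      (Y := {y | ∃ q ∈ propagationSet H A ^ k, q * (g : G ⧸ H) = y})
      (f := (leftMul A ^ k) (delta g a))
      (fun y hy => ih y fun q hq h => hy ⟨q, hq, h⟩) x ?_
    rintro q hq ⟨r, hr, h⟩
    refine hx (q * r) (pow_succ' (propagationSet H A) k ▸ Set.mul_mem_mul hq hr) ?_
    rw [mul_assoc, h, mul_inv_cancel_left]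
    rfl

theorem leftMul_pow_delta_mem (A : Matrix (Fin d) (Fin d) (TwistedGroupAlgebra σ)) {k : ℕ}
    {X : Finset (G ⧸ H)} {g : G} (a : Fin d)
    (h : ∀ q ∈ propagationSet H A ^ k, q * (g : G ⧸ H) ∈ X) :
    (leftMul A ^ k) (delta g a) ∈ supportedOn H d X := fun x hx =>
  leftMul_pow_delta_apply A k g a x fun q hq hqx => hx (hqx ▸ h q hq)

/-- Far from the boundary, powers of the truncation agree with powers of the operator. -/
theorem coe_truncation_pow_delta (A : Matrix (Fin d) (Fin d) (TwistedGroupAlgebra σ)) (k : ℕ)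
    {X : Finset (G ⧸ H)} {g : G} (hg : (g : G ⧸ H) ∈ X) (a : Fin d)
    (h : ∀ q ∈ propagationSet H A ^ k, q * (g : G ⧸ H) ∈ X) :
    (((truncation H X (leftMul A)) ^ k) ⟨delta g a, delta_mem H X g hg a⟩ : L2 G d)
      = (leftMul A ^ k) (delta g a) := by
  induction k with
  | zero => rfl
  | succ k ih =>
    -- Since `1` belongs to the propagation set, its powers increase, so the condition for `k + 1`
    -- contains the one for `k`.
    have ih' := ih fun q hq => h q
      (Set.pow_subset_pow_right (Set.mem_insert _ _) k.le_succ hq)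
    rw [pow_succ', pow_succ']
    change (truncation H X (leftMul A) _ : L2 G d) = leftMul A ((leftMul A ^ k) (delta g a))
    have hA : leftMul A (((truncation H X (leftMul A)) ^ k)
        ⟨delta g a, delta_mem H X g hg a⟩ : L2 G d) = (leftMul A ^ (k + 1)) (delta g a) := by
      rw [ih', pow_succ']
      rfl
    -- The next image is still supported over `X`, so the projection in the truncation acts
    -- trivially on it.
    refine (coe_truncation_of_mem (leftMul A) ?_).trans (congrArg (leftMul A) ih')
    exact hA ▸ leftMul_pow_delta_mem A a h

theorem coe_truncation_pow_sectionFamily (A : Matrix (Fin d) (Fin d) (TwistedGroupAlgebra σ))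
    (k : ℕ) {X : Finset (G ⧸ H)} (i : X × Fin d)
    (h : (i.1 : G ⧸ H) ∉ exitSet (propagationSet H A ^ k) X) :
    (((truncation H X (leftMul A)) ^ k) (sectionFamily s hs X i) : L2 G d)
      = (leftMul A ^ k) (delta (s i.1) i.2) := by
  refine coe_truncation_pow_delta A k ((hs i.1).symm ▸ i.1.2) i.2 fun q hq => ?_
  rw [hs]
  exact mem_of_notMem_exitSet i.1.2 h hq

/-- The members of the family `δ_{s(x)} ⊗ e_a` with `x` close to the boundary of `X`. -/
def exitIndices (L : Set (G ⧸ H)) (X : Finset (G ⧸ H)) (d : ℕ) : Finset (X × Fin d) := by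
  classical exact Finset.univ.filter fun i => (i.1 : G ⧸ H) ∈ exitSet L X

theorem mem_exitIndices {L : Set (G ⧸ H)} {X : Finset (G ⧸ H)} {i : X × Fin d} :
    i ∈ exitIndices L X d ↔ (i.1 : G ⧸ H) ∈ exitSet L X := by
  simp [exitIndices]

theorem card_exitIndices_le (L : Set (G ⧸ H)) (X : Finset (G ⧸ H)) (d : ℕ) :
    (exitIndices L X d).card ≤ d * (exitSet L X).card := by
  classical
  have h : (exitIndices L X d).card ≤ (exitSet L X ×ˢ (Finset.univ : Finset (Fin d))).card := by
    refine Finset.card_le_card_of_injOn (fun i => ((i.1 : G ⧸ H), i.2)) (fun i hi => ?_) ?_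
    · simpa using mem_exitIndices.1 hi
    · rintro ⟨⟨x, hx⟩, a⟩ - ⟨⟨y, hy⟩, b⟩ - hxy
      simpa using hxy
  rw [Finset.card_product, Finset.card_univ, Fintype.card_fin, mul_comm] at h
  exact h

theorem IsFolner.tendsto_card_exitIndices {S : Finset (G ⧸ H)}
    (hS : Subgroup.closure (S : Set (G ⧸ H)) = ⊤) {X : ℕ → Finset (G ⧸ H)} (hX : IsFolner S X)
    {L : Set (G ⧸ H)} (hL : L.Finite) (d : ℕ) :
    Tendsto (fun m => ((exitIndices L (X m) d).card : ℝ) / (X m).card) atTop (𝓝 0) := by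
  refine squeeze_zero (fun m => by positivity) (fun m => ?_)
    (by simpa using (hX.tendsto_card_exitSet hS hL).const_mul (d : ℝ))
  rw [← mul_div_assoc]
  gcongr
  exact_mod_cast card_exitIndices_le L (X m) d

/-- Only boundary indices contribute, since elsewhere the diagonal entries agree. At each boundary
index both entries are at most `‖leftMul A‖ ^ k`. -/
theorem abs_reTrace_truncation_pow_sub_le
    (A : Matrix (Fin d) (Fin d) (TwistedGroupAlgebra σ)) (k : ℕ) (X : Finset (G ⧸ H)) :
    |reTrace (sectionFamily s hs X) ((truncation H X (leftMul A)) ^ k)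
        - X.card * reTrace (delta (1 : G)) (leftMul A ^ k)|
      ≤ (exitIndices (propagationSet H A ^ k) X d).card * (2 * ‖leftMul A‖ ^ k) := by
  classical
  have hmem : leftMul A ^ k ∈ twistedVN σ d := pow_mem (leftMul_mem_twistedVN A) k
  have hpow {E : Type _} [NormedAddCommGroup E] [InnerProductSpace ℂ E] (B : E →L[ℂ] E)
      (hB : ‖B‖ ≤ ‖leftMul A‖) {x : E} (hx : ‖x‖ = 1) :
      |(inner ℂ x ((B ^ k) x)).re| ≤ ‖leftMul A‖ ^ k := by
    have h1 : ‖(B ^ k) x‖ ≤ ‖B‖ ^ k * ‖x‖ := by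
      clear hB
      induction k with
      | zero => simp
      | succ k ih =>
        rw [pow_succ', pow_succ' ‖B‖, mul_assoc]
        exact (B.le_opNorm _).trans
          (mul_le_mul_of_nonneg_left (ih (pow_mem (leftMul_mem_twistedVN A) k)) (norm_nonneg _))
    calc |(inner ℂ x ((B ^ k) x)).re| ≤ ‖inner ℂ x ((B ^ k) x)‖ := Complex.abs_re_le_norm _
      _ ≤ ‖x‖ * ‖(B ^ k) x‖ := norm_inner_le_norm _ _
      _ ≤ ‖B‖ ^ k := by simpa [hx] using h1
      _ ≤ _ := by gcongr
  rw [← sum_re_inner_delta, reTrace, ← Finset.sum_sub_distrib]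
  refine (Finset.abs_sum_le_sum_abs _ _).trans ?_
  rw [← nsmul_eq_mul, ← Finset.sum_const, ← Finset.sum_subset (Finset.subset_univ _)]
  · refine Finset.sum_le_sum fun i _ => (abs_sub _ _).trans ?_
    have h1 := hpow _ (norm_truncation_le (H := H) (X := X) (leftMul A))
      (norm_sectionFamily (s := s) (hs := hs) i)
    have h2 := hpow (leftMul A) le_rfl (norm_delta (1 : G) i.2)
    rw [two_mul]
    exact add_le_add h1 h2
  · intro i _ hi
    rw [re_inner_sectionFamily_of_eq hmem, sub_self, abs_zero]
    rw [coe_truncation_pow_sectionFamily A k i fun h => hi (mem_exitIndices.2 h)]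

theorem tendsto_reTrace_truncation_pow
    (A : Matrix (Fin d) (Fin d) (TwistedGroupAlgebra σ)) {S : Finset (G ⧸ H)}
    (hS : Subgroup.closure (S : Set (G ⧸ H)) = ⊤) {X : ℕ → Finset (G ⧸ H)} (hX : IsFolner S X)
    (k : ℕ) :
    Tendsto (fun m => reTrace (sectionFamily s hs (X m)) ((truncation H (X m) (leftMul A)) ^ k)
      / (X m).card) atTop (𝓝 (reTrace (delta (1 : G)) (leftMul A ^ k))) := by
  rw [tendsto_iff_dist_tendsto_zero]
  have h := (hX.tendsto_card_exitIndices hS (finite_propagationSet_pow A k) d).mul_const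
    (2 * ‖leftMul A‖ ^ k)
  rw [zero_mul] at h
  refine squeeze_zero (fun _ => dist_nonneg) (fun m => ?_) h
  have hN : (0 : ℝ) < (X m).card := by exact_mod_cast (hX.nonempty m).card_pos
  rw [Real.dist_eq, div_sub' hN.ne', abs_div, abs_of_pos hN, div_mul_eq_mul_div]
  gcongr
  exact abs_reTrace_truncation_pow_sub_le A k (X m)

theorem isSelfAdjoint_sub_algebraMap {E : Type*} [NormedAddCommGroup E] [InnerProductSpace ℂ E]
    [CompleteSpace E] {B : E →L[ℂ] E} (hB : IsSelfAdjoint B) (t : ℝ) :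
    IsSelfAdjoint (B - algebraMap ℝ (E →L[ℂ] E) t) :=
  hB.sub (IsSelfAdjoint.algebraMap _ (IsSelfAdjoint.all t))

theorem commute_sub_algebraMap {E : Type*} [NormedAddCommGroup E] [InnerProductSpace ℂ E]
    {U B : E →L[ℂ] E} (h : Commute U B) (t : ℝ) : Commute U (B - algebraMap ℝ (E →L[ℂ] E) t) :=
  h.sub_right (Algebra.commute_algebraMap_right t U)

theorem sub_algebraMap_apply {E : Type*} [NormedAddCommGroup E] [InnerProductSpace ℂ E]
    (B : E →L[ℂ] E) (t : ℝ) (x : E) : (B - algebraMap ℝ (E →L[ℂ] E) t) x = B x - t • x := by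
  simp [Algebra.algebraMap_eq_smul_one]

theorem kerProj_sub_algebraMap_mem_twistedVN {T : L2 G d →L[ℂ] L2 G d} (hT : IsSelfAdjoint T)
    (h : T ∈ twistedVN σ d) (t : ℝ) : kerProj (T - algebraMap ℝ _ t) ∈ twistedVN σ d :=
  mem_centralizer_iff_commute.2 fun U hU => kerProj_commute (isSelfAdjoint_sub_algebraMap hT t)
    (commute_sub_algebraMap (mem_centralizer_iff_commute.1 h U hU) t)

/-- Away from the boundary the truncation of `A - t` sends the basis vector into the range of `A -
t`, which is orthogonal to `ker (A - t)` by self-adjointness. -/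
theorem truncation_kerProj_apply_truncation_sub
    (A : Matrix (Fin d) (Fin d) (TwistedGroupAlgebra σ)) (hA : IsSelfAdjoint (leftMul A)) (t : ℝ)
    {X : Finset (G ⧸ H)} {i : X × Fin d} (hi : i ∉ exitIndices (propagationSet H A ^ 1) X d) :
    truncation H X (kerProj (leftMul A - algebraMap ℝ _ t))
      ((truncation H X (leftMul A) - algebraMap ℝ _ t) (sectionFamily s hs X i)) = 0 := by
  have h1 := coe_truncation_pow_sectionFamily (s := s) (hs := hs) A 1 i
    fun h => hi (mem_exitIndices.2 h)
  rw [pow_one, pow_one] at h1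
  have h2 : (((truncation H X (leftMul A) - algebraMap ℝ _ t) (sectionFamily s hs X i) :
      supportedOn H d X) : L2 G d)
      = (leftMul A - algebraMap ℝ _ t) (delta (s i.1) i.2) := by
    refine (congrArg Subtype.val (sub_algebraMap_apply _ t (sectionFamily s hs X i))).trans ?_
    refine Eq.trans ?_ (sub_algebraMap_apply (leftMul A) t (delta (s i.1) i.2)).symm
    exact congrArg (fun f : L2 G d => f - t • delta (s i.1) i.2) h1
  have h3 : kerProj (leftMul A - algebraMap ℝ _ t)
      (((truncation H X (leftMul A) - algebraMap ℝ _ t) (sectionFamily s hs X i) :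
        supportedOn H d X) : L2 G d) = 0 := by
    rw [h2]
    exact kerProj_apply_apply (isSelfAdjoint_sub_algebraMap hA t) _
  refine Subtype.ext ((coe_truncation_of_mem _ ?_).trans h3)
  exact h3 ▸ zero_mem _

/-- The eigenspaces of the truncations are, up to a boundary term, at least as large as those of
the operator. -/
theorem reTrace_kerProj_le_truncation {σ' : Multiplier (G ⧸ H)}
    (A : Matrix (Fin d) (Fin d) (TwistedGroupAlgebra (σ'.pullback (QuotientGroup.mk' H))))
    (hA : IsSelfAdjoint (leftMul A)) (t : ℝ) (X : Finset (G ⧸ H)) :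
    X.card * reTrace (delta (1 : G)) (kerProj (leftMul A - algebraMap ℝ _ t))
      ≤ reTrace (sectionFamily s hs X) (kerProj (truncation H X (leftMul A) - algebraMap ℝ _ t))
        + (exitIndices (propagationSet H A ^ 1) X d).card := by
  have hmem := leftMul_mem_twistedVN A
  have hker := kerProj_sub_algebraMap_mem_twistedVN hA hmem t
  have hX : truncation H X (leftMul A) ∈ equivariantAlgebra H d X :=
    truncation_mem_equivariantAlgebra hmem
  have hkerX : truncation H X (kerProj (leftMul A - algebraMap ℝ _ t))
      ∈ equivariantAlgebra H d X := truncation_mem_equivariantAlgebra hker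
  rw [← reTrace_truncation_of_mem_twistedVN (s := s) (hs := hs) hker X]
  exact reTrace_le_reTrace_kerProj_add norm_sectionFamily
    (fun Y hY => sum_norm_sq_sectionFamily hY)
    (isSelfAdjoint_sub_algebraMap (isSelfAdjoint_truncation hA) t)
    (fun U hU => commute_sub_algebraMap (mem_centralizer_iff_commute.1 hX U hU) t)
    (truncation_kerProj_nonneg _) ((norm_truncation_le _).trans (norm_kerProj_le _))
    (mem_centralizer_iff_commute.1 hkerX) _
    fun i hi => truncation_kerProj_apply_truncation_sub A hA t hi

end Exhaustion

end TwistedGroup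

end

/-! ### The theorem -/

open TwistedGroup
theorem theorem7p1 {G : Type*} [Group G] (H : Subgroup G) [H.Normal]
    (S : Finset (G ⧸ H)) (hS : Subgroup.closure (S : Set (G ⧸ H)) = ⊤)
    (hQ : IsAmenable (G ⧸ H))
    (σ' : Multiplier (G ⧸ H)) (d : ℕ)
    (A : Matrix (Fin d) (Fin d) (TwistedGroupAlgebra (σ'.pullback (QuotientGroup.mk' H))))
    (hA : IsSelfAdjoint (leftMul A))
    (s : G ⧸ H → G) (hs : ∀ q : G ⧸ H, (s q : G ⧸ H) = q)
    (X : ℕ → Finset (G ⧸ H)) (hX : IsFolner S X) :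
    (leftMul A ∈ twistedVN (σ'.pullback (QuotientGroup.mk' H)) d ∧
      ∀ t : ℝ, spectralProjection (leftMul A) t ∈
        twistedVN (σ'.pullback (QuotientGroup.mk' H)) d) ∧
    (∀ Y : Finset (G ⧸ H), truncation H Y (leftMul A) ∈ equivariantAlgebra H d Y ∧
      ∀ t : ℝ, spectralProjection (truncation H Y (leftMul A)) t ∈ equivariantAlgebra H d Y) ∧
    ∀ t : ℝ,
      Tendsto
        (fun m => truncTrace H s hs (X m) (spectralProjection (truncation H (X m) (leftMul A)) t))
        atTop (𝓝 (vnTrace (spectralProjection (leftMul A) t))) := by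
  have hmem := leftMul_mem_twistedVN A
  refine ⟨⟨hmem, spectralProjection_mem_centralizer hA hmem⟩, fun Y => ?_, fun t => ?_⟩
  · have hY : truncation H Y (leftMul A) ∈ equivariantAlgebra H d Y :=
      truncation_mem_equivariantAlgebra hmem
    exact ⟨hY, spectralProjection_mem_centralizer (isSelfAdjoint_truncation hA) hY⟩
  have hN (m : ℕ) : (0 : ℝ) < (X m).card := by exact_mod_cast (hX.nonempty m).card_pos
  simp only [spectralProjection_eq_kerProj, truncTrace_kerProj, vnTrace_kerProj]
  -- Both traces have been rewritten as real numbers, so the real-valued convergence result applies,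
  -- with norm bound `R = ‖leftMul A‖` and `δ m` the proportion of boundary vectors relative to
  -- `#X_m`.
  refine (Complex.continuous_ofReal.tendsto _).comp ?_
  refine tendsto_reTrace_spectralProjection (w := delta (1 : G)) (norm_delta 1)
    (fun m => norm_sectionFamily) hA (fun m => isSelfAdjoint_truncation hA) le_rfl
    (fun m => norm_truncation_le _) hN (fun m => ?_)
    (tendsto_reTrace_truncation_pow A hS hX) t
    (hX.tendsto_card_exitIndices hS (finite_propagationSet_pow A 1) d) fun m => ?_
  · simp [mul_comm]
  · rw [← add_div, le_div_iff₀ (hN m), mul_comm]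
    exact reTrace_kerProj_le_truncation A hA t (X m)
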